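/- Let $d\ge 0$ and let $p_*\propto e^{-f_*}$ be a probability density on $\mathbb{R}^d$ (so $e^{-f_*}$ is integrable). For $t>0$ let $p_t$ be the density of the Ornstein–Uhlenbeck process $dx_t=-x_t\,dt+\sqrt2\,dB_t$ started from $x_0\sim p_0=p_*$, that is, $$p_t(x)=\int p_*(x_0)\,\bigl(2\pi(1-e^{-2t})\bigr)^{-d/2}\exp\Bigl(-\frac{\|x-e^{-t}x_0\|^2}{2(1-e^{-2t})}\Bigr)dx_0 ,$$ and let $q_t(\cdot\,|\,x)$ be the posterior law of $x_0$ given $x_t=x$, with density $$q_t(x_0|x)\propto\exp\Bigl(-f_*(x_0)-\frac{\|x-e^{-t}x_0\|^2}{2(1-e^{-2t})}\Bigr)\quad(t>0),\qquad q_0(\cdot\,|\,x)=\delta_x .$$ Assume: [A1] there is $L\ge 0$ such that for every $t\ge 0$ the score $\nabla\ln p_t$ exists everywhere and is $L$-Lipschitz; [A4] for every $r>0$ the function $v_r(x)=f_*(x)+r\|x\|^2$ is convex for $\|x\|\ge R(r)$, where $R$ is a given real-valued function (for instance $R(r)=c_R/r^n$ with $c_R,n>0$). This means: if $x=\sum_{i=1}^k\lambda_i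 x_i$ with $\lambda_i\ge 0$, $\sum_i\lambda_i=1$, and $\|x\|\ge R(r)$, $\|x_i\|\ge R(r)$ for all $i$, then $v_r(x)\le\sum_i\lambda_i v_r(x_i)$. A probability measure $\nu$ on $\mathbb{R}^d$ satisfies the log-Sobolev inequality with constant $\mu>0$ if for every smooth $g:\mathbb{R}^d\to\mathbb{R}$ with $\mathbb{E}_\nu[g^2]<\infty$ $$\mathbb{E}_\nu[g^2\ln g^2]-\mathbb{E}_\nu[g^2]\ln\mathbb{E}_\nu[g^2]\le\frac2\mu\,\mathbb{E}_\nu[\|\nabla g\|^2]$$ (the right-hand side may be $+\infty$; if it is finite, the inequality includes that $g^2\ln g^2$ is $\nu$-integrable). Then for every $t>0$ and every $x\in\mathbb{R}^d$ the posterior $q_t(\cdot\,|\,x)$ is a probability measure that satisfies the log-Sobolev inequality with constant $$\frac{e^{-2t}}{6(1-e^{-2t})}\cdot\exp\Bigl(-48\,L\,R^2\Bigl(\frac{e^{-2t}}{6(1-e^{-2t})}\Bigr)\Bigr),\qquad\text{where } R^2(r)=(R(r))^2,$$ and for $t=0$ and every $x$ the posterior $q_0(\cdot\,|\,x)=\delta_x$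 satisfies it with every constant $\mu>0$. -/

import Mathlib

open scoped NNReal ContDiff
open MeasureTheory

noncomputable section

namespace ReverseDiffusion

/-- Euclidean space `ℝ^d`. -/
abbrev E (d : ℕ) : Type := EuclideanSpace ℝ (Fin d)

variable {d : ℕ}

/-- The target density `p_* ∝ exp (-f)`. -/
def targetDensity (f : E d → ℝ) (x : E d) : ℝ :=
  Real.exp (-f x) / ∫ y, Real.exp (-f y)

/-- Transition density `p_{t|0}(x | x₀)`, for `t > 0`, of the Ornstein-Uhlenbeck process
`dx_t = -x_t dt + √2 dB_t`: the density of `N(e^{-t} x₀, (1 - e^{-2t}) I)` at `x`. -/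
def ouKernel (t : ℝ) (x x₀ : E d) : ℝ :=
  (2 * Real.pi * (1 - Real.exp (-2 * t))) ^ (-(d : ℝ) / 2) *
    Real.exp (-‖x - Real.exp (-t) • x₀‖ ^ 2 / (2 * (1 - Real.exp (-2 * t))))

/-- Density `p_t` of the Ornstein-Uhlenbeck process started from `p_0 = p_*`. -/
def forwardDensity (f : E d → ℝ) (t : ℝ) (x : E d) : ℝ :=
  if t = 0 then targetDensity f x else ∫ x₀, ouKernel t x x₀ * targetDensity f x₀

/-- For all `t ≥ 0`, the score `∇ ln p_t` exists everywhere and is `L`-Lipschitz. -/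
def ScoreLipschitz (f : E d → ℝ) (L : ℝ≥0) : Prop :=
  ∀ t : ℝ, 0 ≤ t →
    Differentiable ℝ (fun x => Real.log (forwardDensity f t x)) ∧
    LipschitzWith L (gradient (fun x => Real.log (forwardDensity f t x)))

/-- `v` is convex on the (in general nonconvex) set `‖x‖ ≥ ρ`: whenever a point of this set is
a convex combination of points of this set, `v` at this point is at most the corresponding
combination of the values of `v`. -/
def ConvexOutsideBall (v : E d → ℝ) (ρ : ℝ) : Prop :=
  ∀ (k : ℕ) (w : Fin k → ℝ) (y : Fin k → E d),
    (∀ i, 0 ≤ w i) → ∑ i, w i = 1 → (∀ i, ρ ≤ ‖y i‖) → ρ ≤ ‖∑ i, w i • y i‖ →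
      v (∑ i, w i • y i) ≤ ∑ i, w i * v (y i)

/-- For every `r > 0`, the function `f + r ‖·‖²` is convex on `‖x‖ ≥ R r`. -/
def ConvexifiableOutside (f : E d → ℝ) (R : ℝ → ℝ) : Prop :=
  ∀ r : ℝ, 0 < r → ConvexOutsideBall (fun x => f x + r * ‖x‖ ^ 2) (R r)

/-- The unnormalized posterior density
`x₀ ↦ exp (-f x₀ - ‖x - e^{-t} x₀‖² / (2 (1 - e^{-2t})))`, for `t > 0`. -/
def posteriorWeight (f : E d → ℝ) (t : ℝ) (x x₀ : E d) : ℝ :=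
  Real.exp (-f x₀ - ‖x - Real.exp (-t) • x₀‖ ^ 2 / (2 * (1 - Real.exp (-2 * t))))

/-- The posterior `q_t(· | x)`, the law of `x_0` given `x_t = x`. At `t = 0` it is the Dirac
mass at `x`. -/
def posterior (f : E d → ℝ) (t : ℝ) (x : E d) : Measure (E d) :=
  if t = 0 then Measure.dirac x
  else volume.withDensity fun x₀ =>
    ENNReal.ofReal (posteriorWeight f t x x₀ / ∫ y, posteriorWeight f t x y)

/-- The probability measure `ν` satisfies the log-Sobolev inequality with constant `μ > 0`:
`E[g² ln g²] - E[g²] ln E[g²] ≤ (2 / μ) E[‖∇g‖²]` for all smooth `g` with `E[g²] < ∞`.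
If `E[‖∇g‖²] = ∞` there is nothing to say; if it is finite, the inequality includes that
`E[g² ln g²]` is finite. -/
def SatisfiesLSI (ν : Measure (E d)) (μ : ℝ) : Prop :=
  IsProbabilityMeasure ν ∧ 0 < μ ∧
  ∀ g : E d → ℝ, ContDiff ℝ ∞ g →
    Integrable (fun x => g x ^ 2) ν →
    Integrable (fun x => ‖gradient g x‖ ^ 2) ν →
      Integrable (fun x => g x ^ 2 * Real.log (g x ^ 2)) ν ∧
      (∫ x, g x ^ 2 * Real.log (g x ^ 2) ∂ν)
          - (∫ x, g x ^ 2 ∂ν) * Real.log (∫ x, g x ^ 2 ∂ν)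
        ≤ 2 / μ * ∫ x, ‖gradient g x‖ ^ 2 ∂ν

end ReverseDiffusion

end

/-! Write `e = exp (-t)`, `σ = 1 - e²` and `r = e² / (6σ)`. The posterior has potential `f + q`,
where `q y = ‖x - e y‖² / (2σ)` equals `3r‖y‖²` plus an affine function. One share `r‖y‖²` makes `f`
convex outside the ball of radius `ρ = R r`; the other two provide strong convexity.

The score bound at time zero says that `∇f` is `L`-Lipschitz. Let `W` be the supremum of the
tangents of `v = f + r‖·‖²` at points outside the ball. It is convex and satisfies `v - 28Lρ² ≤ W ≤
v + 20Lρ²` (`exists_convexOn_of_convex_outside_ball`): outside the ball, tangents lie below `v`;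
inside, comparison with the tangent at `0` costs multiples of `Lρ²`. Replacing `v` by `W` in the
potential gives a `4r`-strongly convex function. Strongly log-concave measures satisfy log-Sobolev
with their convexity constant, and the Holley–Stroock principle transfers this to the posterior with
the factor `exp (-48Lρ²)`. The constant `4r` is then weakened to `r`.

Log-Sobolev for strongly log-concave measures is derived from the Prékopa–Leindler inequality with
weights `1 - s` and `s`. To first order as `s → 0`, one side produces the entropy of `exp G`, the
other `1 / (2c)` times the integral of `‖∇G‖² exp G` (`entropy_exp_le`). The choice `G = log (g² +
ε)` gives the usual form. -/

noncomputable section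

/-! ### The Prékopa–Leindler inequality. -/

section

open scoped ENNReal Pointwise

/-- One-dimensional Brunn–Minkowski inequality for compact sets. -/
theorem Real.volume_add_volume_le_of_isCompact {A B C : Set ℝ} (hA : IsCompact A)
    (hB : IsCompact B) (hA₀ : A.Nonempty) (hB₀ : B.Nonempty)
    (h : ∀ x ∈ A, ∀ y ∈ B, x + y ∈ C) : volume A + volume B ≤ volume C := by
  obtain ⟨a, haA, ha⟩ := hA.exists_isGreatest hA₀
  obtain ⟨b, hbB, hb⟩ := hB.exists_isLeast hB₀
  have h1 : volume ((fun x => x + b) '' A) = volume A := by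
    rw [Set.image_add_right, measure_preimage_add_right]
  have h2 : volume ((fun x => a + x) '' B) = volume B := by
    rw [Set.image_add_left, measure_preimage_add]
  have hmB : MeasurableSet ((fun x => a + x) '' B) :=
    (hB.image (by fun_prop)).measurableSet
  -- With `a = max A` and `b = min B`, the translate `A + b` lies to the left of `a + b` and `a + B`
  -- to the right.
  have h3 : AEDisjoint volume ((fun x => x + b) '' A) ((fun x => a + x) '' B) := by
    refine measure_mono_null (t := {a + b}) ?_ (by simp)
    rintro _ ⟨⟨x, hx, rfl⟩, ⟨y, hy, hxy⟩⟩
    have := ha hx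
    have := hb hy
    simp only at hxy ⊢
    rw [Set.mem_singleton_iff]
    linarith
  rw [← h1, ← h2, ← measure_union₀ hmB.nullMeasurableSet h3]
  refine measure_mono (Set.union_subset ?_ ?_)
  · rintro _ ⟨x, hx, rfl⟩
    exact h _ hx _ hbB
  · rintro _ ⟨x, hx, rfl⟩
    exact h _ haA _ hx

/-- One-dimensional Brunn–Minkowski inequality for measurable sets. -/
theorem Real.volume_add_volume_le {A B C : Set ℝ} (hA : MeasurableSet A)
    (hB : MeasurableSet B) (hA₀ : A.Nonempty) (hB₀ : B.Nonempty)
    (h : ∀ x ∈ A, ∀ y ∈ B, x + y ∈ C) : volume A + volume B ≤ volume C := by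
  obtain ⟨a, ha⟩ := hA₀
  obtain ⟨b, hb⟩ := hB₀
  rw [hA.measure_eq_iSup_isCompact, hB.measure_eq_iSup_isCompact]
  have key : ∀ K ⊆ A, IsCompact K → ∀ K' ⊆ B, IsCompact K' →
      volume K + volume K' ≤ volume C := by
    intro K hKA hK K' hKB hK'
    -- The compact subsets may be empty, so a point of `A` and a point of `B` are adjoined.
    refine (add_le_add (measure_mono (Set.subset_insert a K))
      (measure_mono (Set.subset_insert b K'))).trans ?_
    refine Real.volume_add_volume_le_of_isCompact (hK.insert a) (hK'.insert b)
      (Set.insert_nonempty _ _) (Set.insert_nonempty _ _) fun x hx y hy => ?_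
    exact h x (Set.insert_subset ha hKA hx) y (Set.insert_subset hb hKB hy)
  have e : ∀ (S : Set ℝ), (⨆ (K : Set ℝ) (_ : K ⊆ S) (_ : IsCompact K), volume K)
      = ⨆ K : {K : Set ℝ // K ⊆ S ∧ IsCompact K}, volume (K : Set ℝ) := by
    intro S
    simp only [iSup_subtype, iSup_and]
  rw [e, e]
  have : ∀ S : Set ℝ, Nonempty {K : Set ℝ // K ⊆ S ∧ IsCompact K} := fun S =>
    ⟨⟨∅, Set.empty_subset _, isCompact_empty⟩⟩
  exact ENNReal.iSup_add_iSup_le fun K K' => key K K.2.1 K.2.2 K' K'.2.1 K'.2.2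

theorem Real.mul_volume_add_mul_volume_le {t s : ℝ} (ht : 0 < t) (hs : 0 < s) {A B C : Set ℝ}
    (hA : MeasurableSet A) (hB : MeasurableSet B) (hA₀ : A.Nonempty) (hB₀ : B.Nonempty)
    (h : ∀ x ∈ A, ∀ y ∈ B, t * x + s * y ∈ C) :
    ENNReal.ofReal t * volume A + ENNReal.ofReal s * volume B ≤ volume C := by
  have h1 : ∀ {r : ℝ} (_ : 0 < r) (S : Set ℝ), ENNReal.ofReal r * volume S = volume (r • S) := by
    intro r hr S
    rw [Measure.addHaar_smul]
    simp [abs_of_pos hr]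
  rw [h1 ht, h1 hs]
  refine Real.volume_add_volume_le (hA.const_smul₀ t) (hB.const_smul₀ s) hA₀.smul_set
    hB₀.smul_set ?_
  rintro _ ⟨x, hx, rfl⟩ _ ⟨y, hy, rfl⟩
  exact h x hx y hy

theorem lintegral_eq_lintegral_meas_lt_toReal {u : ℝ → ℝ≥0∞} (hu : Measurable u)
    (hu1 : ∀ x, u x ≤ 1) :
    ∫⁻ x, u x = ∫⁻ r in Set.Ioi (0 : ℝ), volume {x | r < (u x).toReal} := by
  rw [← lintegral_eq_lintegral_meas_lt _ (Filter.Eventually.of_forall fun x => ENNReal.toReal_nonneg)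
    hu.ennreal_toReal.aemeasurable]
  refine lintegral_congr fun x => ?_
  rw [ENNReal.ofReal_toReal ((hu1 x).trans_lt ENNReal.one_lt_top).ne]

/-- The additive form of the one-dimensional Prékopa–Leindler inequality, for functions with
supremum `1`. -/
theorem Real.lintegral_add_lintegral_le_of_min_le {t s : ℝ} (ht : 0 < t) (hs : 0 < s)
    {u v w : ℝ → ℝ≥0∞} (hu : Measurable u) (hv : Measurable v) (hw : Measurable w)
    (hu1 : ⨆ x, u x = 1) (hv1 : ⨆ x, v x = 1)
    (h : ∀ x y, min (u x) (v y) ≤ w (t * x + s * y)) :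
    ENNReal.ofReal t * (∫⁻ x, u x) + ENNReal.ofReal s * (∫⁻ x, v x) ≤ ∫⁻ x, w x := by
  have hu2 : ∀ x, u x ≤ 1 := fun x => hu1 ▸ le_iSup u x
  have hv2 : ∀ x, v x ≤ 1 := fun x => hv1 ▸ le_iSup v x
  have hfin : ∀ {z : ℝ≥0∞}, z ≤ 1 → z ≠ ⊤ := fun hz => (hz.trans_lt ENNReal.one_lt_top).ne
  -- Truncation at `1` keeps `w` finite for `toReal` and loses nothing: only levels `r < 1` matter,
  -- where the superlevel sets of `u` and `v` are nonempty and one-dimensional Brunn–Minkowski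
  -- applies.
  have hle : ∫⁻ x, min (w x) 1 ≤ ∫⁻ x, w x := lintegral_mono fun x => min_le_left _ _
  refine le_trans ?_ hle
  rw [lintegral_eq_lintegral_meas_lt_toReal hu hu2, lintegral_eq_lintegral_meas_lt_toReal hv hv2,
    lintegral_eq_lintegral_meas_lt_toReal (hw.min measurable_const) (fun x => min_le_right _ _),
    ← lintegral_const_mul' _ _ ENNReal.ofReal_ne_top,
    ← lintegral_const_mul' _ _ ENNReal.ofReal_ne_top]
  refine (le_lintegral_add _ _).trans (setLIntegral_mono' measurableSet_Ioi fun r hr => ?_)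
  have hr0 : (0 : ℝ) < r := hr
  have hne : ∀ {g : ℝ → ℝ≥0∞} (_ : ⨆ x, g x = 1) (_ : ∀ x, g x ≤ 1), r < 1 →
      {x | r < (g x).toReal}.Nonempty := by
    intro g hg1 hg2 hr1
    have : ENNReal.ofReal r < ⨆ x, g x := by
      rw [hg1]
      exact ENNReal.ofReal_lt_one.2 hr1
    obtain ⟨x, hx⟩ := lt_iSup_iff.1 this
    exact ⟨x, (ENNReal.ofReal_lt_iff_lt_toReal hr0.le (hfin (hg2 x))).1 hx⟩
  rcases lt_or_ge r 1 with hr1 | hr1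
  · refine Real.mul_volume_add_mul_volume_le ht hs
      (measurableSet_lt measurable_const hu.ennreal_toReal)
      (measurableSet_lt measurable_const hv.ennreal_toReal) (hne hu1 hu2 hr1) (hne hv1 hv2 hr1) ?_
    intro x hx y hy
    have hx' := (ENNReal.ofReal_lt_iff_lt_toReal hr0.le (hfin (hu2 x))).2 hx
    have hy' := (ENNReal.ofReal_lt_iff_lt_toReal hr0.le (hfin (hv2 y))).2 hy
    refine (ENNReal.ofReal_lt_iff_lt_toReal hr0.le (hfin (min_le_right _ _))).1 ?_
    exact lt_min ((lt_min hx' hy').trans_le (h x y)) (ENNReal.ofReal_lt_one.2 hr1)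
  · have hem : ∀ {g : ℝ → ℝ≥0∞} (_ : ∀ x, g x ≤ 1), {x | r < (g x).toReal} = ∅ := by
      intro g hg
      ext x
      simp only [Set.mem_ofPred_eq, Set.mem_empty_iff_false, iff_false, not_lt]
      exact (ENNReal.toReal_mono ENNReal.one_ne_top (hg x)).trans (by simpa using hr1)
    rw [hem hu2, hem hv2]
    simp

theorem ENNReal.rpow_mul_rpow_le_add {t s : ℝ} (ht : 0 < t) (hs : 0 < s) (hts : t + s = 1)
    (a b : ℝ≥0∞) : a ^ t * b ^ s ≤ ENNReal.ofReal t * a + ENNReal.ofReal s * b := by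
  have hpq : (t⁻¹).HolderConjugate s⁻¹ :=
    Real.holderConjugate_iff.2 ⟨(one_lt_inv₀ ht).2 (by linarith), by simpa using hts⟩
  have := ENNReal.young_inequality (a ^ t) (b ^ s) hpq
  rw [← ENNReal.rpow_mul, ← ENNReal.rpow_mul, mul_inv_cancel₀ ht.ne', mul_inv_cancel₀ hs.ne',
    ENNReal.rpow_one, ENNReal.rpow_one, ENNReal.ofReal_inv_of_pos ht,
    ENNReal.ofReal_inv_of_pos hs, div_eq_mul_inv, div_eq_mul_inv, inv_inv, inv_inv] at this
  rwa [mul_comm a, mul_comm b] at this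

theorem ENNReal.min_le_rpow_mul_rpow {t s : ℝ} (ht : 0 < t) (hs : 0 < s) (hts : t + s = 1)
    (a b : ℝ≥0∞) : min a b ≤ a ^ t * b ^ s := by
  have h : min a b = min a b ^ t * min a b ^ s := by
    rw [← ENNReal.rpow_add_of_nonneg _ _ ht.le hs.le, hts, ENNReal.rpow_one]
  rw [h]
  exact mul_le_mul' (ENNReal.rpow_le_rpow (min_le_left _ _) ht.le)
    (ENNReal.rpow_le_rpow (min_le_right _ _) hs.le)

/-- Dividing by the suprema reduces to the additive form: a minimum is at most a weighted geometric
mean, which is at most the weighted arithmetic mean. The hypothesis scales by `c = a ^ t * b ^ s`,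
as does the conclusion. -/
theorem Real.prekopa_leindler_of_bounded {t s : ℝ} (ht : 0 < t) (hs : 0 < s) (hts : t + s = 1)
    {u v w : ℝ → ℝ≥0∞} (hu : Measurable u) (hv : Measurable v) (hw : Measurable w)
    (hu1 : ⨆ x, u x ≠ ⊤) (hv1 : ⨆ x, v x ≠ ⊤)
    (h : ∀ x y, u x ^ t * v y ^ s ≤ w (t * x + s * y)) :
    (∫⁻ x, u x) ^ t * (∫⁻ x, v x) ^ s ≤ ∫⁻ x, w x := by
  set a := ⨆ x, u x with ha
  set b := ⨆ x, v x with hb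
  rcases eq_or_ne a 0 with ha0 | ha0
  · have : ∀ x, u x = 0 := fun x => le_antisymm (ha0 ▸ le_iSup u x) bot_le
    simp [this, ht]
  rcases eq_or_ne b 0 with hb0 | hb0
  · have : ∀ x, v x = 0 := fun x => le_antisymm (hb0 ▸ le_iSup v x) bot_le
    simp [this, hs]
  set c := a ^ t * b ^ s with hc
  have hc0 : c ≠ 0 := mul_ne_zero (by simp [ENNReal.rpow_eq_zero_iff, ha0, hu1])
    (by simp [ENNReal.rpow_eq_zero_iff, hb0, hv1])
  have hct : c ≠ ⊤ := ENNReal.mul_ne_top (ENNReal.rpow_ne_top_of_nonneg ht.le hu1)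
    (ENNReal.rpow_ne_top_of_nonneg hs.le hv1)
  have hci : c⁻¹ = a⁻¹ ^ t * b⁻¹ ^ s := by
    rw [hc, ENNReal.mul_inv (Or.inr (ENNReal.rpow_ne_top_of_nonneg hs.le hv1))
      (Or.inl (ENNReal.rpow_ne_top_of_nonneg ht.le hu1)), ENNReal.inv_rpow, ENNReal.inv_rpow]
  have hmain := Real.lintegral_add_lintegral_le_of_min_le ht hs
    (u := fun x => a⁻¹ * u x) (v := fun x => b⁻¹ * v x) (w := fun x => c⁻¹ * w x)
    (hu.const_mul _) (hv.const_mul _) (hw.const_mul _)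
    (by rw [← ENNReal.mul_iSup, ← ha, ENNReal.inv_mul_cancel ha0 hu1])
    (by rw [← ENNReal.mul_iSup, ← hb, ENNReal.inv_mul_cancel hb0 hv1])
    (by
      intro x y
      refine (ENNReal.min_le_rpow_mul_rpow ht hs hts _ _).trans ?_
      rw [ENNReal.mul_rpow_of_nonneg _ _ ht.le, ENNReal.mul_rpow_of_nonneg _ _ hs.le,
        mul_mul_mul_comm, ← hci]
      exact mul_le_mul_right (h x y) _)
  have h2 := (ENNReal.rpow_mul_rpow_le_add ht hs hts _ _).trans hmain
  rw [lintegral_const_mul _ hu, lintegral_const_mul _ hv, lintegral_const_mul _ hw,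
    ENNReal.mul_rpow_of_nonneg _ _ ht.le, ENNReal.mul_rpow_of_nonneg _ _ hs.le,
        mul_mul_mul_comm, ← hci] at h2
  exact (ENNReal.mul_le_mul_iff_right (ENNReal.inv_ne_zero.2 hct) (ENNReal.inv_ne_top.2 hc0)).1 h2

/-- The one-dimensional Prékopa–Leindler inequality. -/
theorem Real.prekopa_leindler {t s : ℝ} (ht : 0 < t) (hs : 0 < s) (hts : t + s = 1)
    {u v w : ℝ → ℝ≥0∞} (hu : Measurable u) (hv : Measurable v) (hw : Measurable w)
    (h : ∀ x y, u x ^ t * v y ^ s ≤ w (t * x + s * y)) :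
    (∫⁻ x, u x) ^ t * (∫⁻ x, v x) ^ s ≤ ∫⁻ x, w x := by
  have hlim : ∀ {g : ℝ → ℝ≥0∞} (_ : Measurable g),
      Filter.Tendsto (fun n : ℕ => ∫⁻ x, min (g x) n) Filter.atTop (nhds (∫⁻ x, g x)) := by
    intro g hg
    refine lintegral_tendsto_of_tendsto_of_monotone (fun n => (hg.min measurable_const).aemeasurable)
      (Filter.Eventually.of_forall fun x n m hnm => min_le_min le_rfl (by exact_mod_cast hnm))
      (Filter.Eventually.of_forall fun x => ?_)
    have := (tendsto_const_nhds (x := g x)).min ENNReal.tendsto_nat_nhds_top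
    simpa using this
  have hb : ∀ (g : ℝ → ℝ≥0∞) (n : ℕ), ⨆ x, min (g x) n ≠ ⊤ := fun g n =>
    ((iSup_le fun x => min_le_right _ _).trans_lt (ENNReal.natCast_lt_top n)).ne
  have key : ∀ n m : ℕ, (∫⁻ x, min (u x) n) ^ t * (∫⁻ x, min (v x) m) ^ s ≤ ∫⁻ x, w x := by
    intro n m
    refine Real.prekopa_leindler_of_bounded ht hs hts (hu.min measurable_const)
      (hv.min measurable_const) hw (hb u n) (hb v m) fun x y => le_trans ?_ (h x y)
    exact mul_le_mul' (ENNReal.rpow_le_rpow (min_le_left _ _) ht.le)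
      (ENNReal.rpow_le_rpow (min_le_left _ _) hs.le)
  -- Multiplication on `[0, ∞]` is discontinuous at `(0, ∞)`, so vanishing integrals are separated
  -- before the limit.
  rcases eq_or_ne (∫⁻ x, u x) 0 with hu0 | hu0
  · simp [hu0, ht]
  rcases eq_or_ne (∫⁻ x, v x) 0 with hv0 | hv0
  · simp [hv0, hs]
  refine le_of_tendsto (ENNReal.Tendsto.mul
    ((ENNReal.continuous_rpow_const.tendsto _).comp (hlim hu)) (Or.inl ?_)
    ((ENNReal.continuous_rpow_const.tendsto _).comp (hlim hv)) (Or.inl ?_))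
    (Filter.Eventually.of_forall fun n => key n n)
  · simp [ENNReal.rpow_eq_zero_iff, hu0, ht.le]
  · simp [ENNReal.rpow_eq_zero_iff, hv0, hs.le]

/-- The Prékopa–Leindler inequality on `Fin n → ℝ`. -/
theorem prekopa_leindler_pi {t s : ℝ} (ht : 0 < t) (hs : 0 < s) (hts : t + s = 1) {n : ℕ}
    {u v w : (Fin n → ℝ) → ℝ≥0∞} (hu : Measurable u) (hv : Measurable v) (hw : Measurable w)
    (h : ∀ x y, u x ^ t * v y ^ s ≤ w (t • x + s • y)) :
    (∫⁻ x, u x) ^ t * (∫⁻ x, v x) ^ s ≤ ∫⁻ x, w x := by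
  induction n with
  | zero =>
    have e : ∀ g : (Fin 0 → ℝ) → ℝ≥0∞, ∫⁻ x, g x = g 0 := by
      intro g
      rw [Measure.volume_pi_eq_dirac 0, lintegral_dirac]
    rw [e, e, e]
    convert h 0 0 using 2
  | succ n ih =>
    let φ := MeasurableEquiv.piFinSuccAbove (fun _ : Fin (n + 1) => ℝ) 0
    have hφ : MeasurePreserving φ.symm :=
      (volume_preserving_piFinSuccAbove (fun _ : Fin (n + 1) => ℝ) 0).symm
    have e : ∀ {g : (Fin (n + 1) → ℝ) → ℝ≥0∞} (_ : Measurable g),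
        ∫⁻ x, g x = ∫⁻ a, ∫⁻ b, g (φ.symm (a, b)) := by
      intro g hg
      rw [← hφ.lintegral_comp hg]
      exact lintegral_prod _ (hg.comp φ.symm.measurable).aemeasurable
    have hlin : ∀ a b a' b', t • φ.symm (a, b) + s • φ.symm (a', b')
        = φ.symm (t * a + s * a', t • b + s • b') := by
      intro a b a' b'
      ext i
      refine Fin.cases ?_ (fun i => ?_) i <;>
      simp [φ, MeasurableEquiv.piFinSuccAbove, Fin.insertNthEquiv]
    have hm : ∀ {g : (Fin (n + 1) → ℝ) → ℝ≥0∞} (_ : Measurable g),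
        Measurable fun p : ℝ × (Fin n → ℝ) => g (φ.symm p) :=
      fun hg => hg.comp φ.symm.measurable
    rw [e hu, e hv, e hw]
    -- The induction hypothesis on slices is exactly the one-dimensional hypothesis for the
    -- marginals in the first coordinate.
    refine Real.prekopa_leindler ht hs hts (hm hu).lintegral_prod_right'
      (hm hv).lintegral_prod_right' (hm hw).lintegral_prod_right' fun a a' => ?_
    refine ih ((hm hu).comp measurable_prodMk_left) ((hm hv).comp measurable_prodMk_left)
      ((hm hw).comp measurable_prodMk_left) fun b b' => ?_
    refine (h _ _).trans_eq ?_
    rw [hlin]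

/-- The Prékopa–Leindler inequality on Euclidean space. -/
theorem prekopa_leindler {t s : ℝ} (ht : 0 < t) (hs : 0 < s) (hts : t + s = 1) {n : ℕ}
    {u v w : EuclideanSpace ℝ (Fin n) → ℝ≥0∞} (hu : Measurable u) (hv : Measurable v)
    (hw : Measurable w) (h : ∀ x y, u x ^ t * v y ^ s ≤ w (t • x + s • y)) :
    (∫⁻ x, u x) ^ t * (∫⁻ x, v x) ^ s ≤ ∫⁻ x, w x := by
  have hφ := PiLp.volume_preserving_toLp (Fin n)
  rw [← hφ.lintegral_comp hu, ← hφ.lintegral_comp hv, ← hφ.lintegral_comp hw]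
  exact prekopa_leindler_pi ht hs hts (hu.comp hφ.measurable) (hv.comp hφ.measurable)
    (hw.comp hφ.measurable) fun x y => h _ _

end

/-! ### Log-Sobolev inequality for strongly log-concave measures. -/

theorem MeasureTheory.integrable_of_abs_le {Ω : Type*} [MeasurableSpace Ω] {μ : Measure Ω}
    [IsFiniteMeasure μ] {g : Ω → ℝ} (hg : Measurable g) {B : ℝ} (h : ∀ x, |g x| ≤ B) :
    Integrable g μ :=
  .of_bound hg.aestronglyMeasurable B (Filter.Eventually.of_forall h)

theorem MeasureTheory.integrable_exp_of_abs_le {Ω : Type*} [MeasurableSpace Ω] {μ : Measure Ω}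
    [IsFiniteMeasure μ] {g : Ω → ℝ} (hg : Measurable g) {B : ℝ} (h : ∀ x, |g x| ≤ B) :
    Integrable (fun x => Real.exp (g x)) μ :=
  integrable_of_abs_le hg.exp (B := Real.exp B) fun x => by
    rw [Real.abs_exp]
    exact Real.exp_le_exp.2 (le_of_abs_le (h x))

theorem MeasureTheory.integrable_mul_exp_of_abs_le {Ω : Type*} [MeasurableSpace Ω] {μ : Measure Ω}
    [IsFiniteMeasure μ] {g k : Ω → ℝ} (hg : Measurable g) {B : ℝ} (h : ∀ x, |g x| ≤ B)
    (hk : Measurable k) {B' : ℝ} (h' : ∀ x, |k x| ≤ B') :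
    Integrable (fun x => k x * Real.exp (g x)) μ :=
  integrable_of_abs_le (hk.mul hg.exp) (B := B' * Real.exp B) fun x => by
    rw [abs_mul, Real.abs_exp]
    exact mul_le_mul (h' x) (Real.exp_le_exp.2 (le_of_abs_le (h x))) (Real.exp_pos _).le
      ((abs_nonneg _).trans (h' x))

/-- A lower bound, to first order in `s`, for the norm of `exp G` in `L^{1/(1-s)}`. -/
theorem integral_exp_add_mul_entropy_le {Ω : Type*} [MeasurableSpace Ω] {μ : Measure Ω}
    [IsProbabilityMeasure μ] {G : Ω → ℝ} (hG : Measurable G) {B : ℝ} (hB : ∀ x, |G x| ≤ B)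
    {t s : ℝ} (ht : 0 < t) (hts : t + s = 1) :
    (∫ x, Real.exp (G x) ∂μ) + s * ((∫ x, G x * Real.exp (G x) ∂μ)
      - (∫ x, Real.exp (G x) ∂μ) * Real.log (∫ x, Real.exp (G x) ∂μ))
      ≤ (∫ x, Real.exp (G x / t) ∂μ) ^ t := by
  set Z := ∫ x, Real.exp (G x) ∂μ with hZ
  have hi := integrable_exp_of_abs_le (μ := μ) hG hB
  have hi' := integrable_mul_exp_of_abs_le (μ := μ) hG hB hG hB
  have hZ0 : 0 < Z := integral_exp_pos hi
  set m := (∫ x, G x * Real.exp (G x) ∂μ) / Z with hm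
  have hmZ : ∫ x, G x * Real.exp (G x) ∂μ = m * Z := by rw [hm, div_mul_cancel₀ _ hZ0.ne']
  have hst : ∀ y : ℝ, y / t = y + s / t * y := by
    intro y
    field_simp
    rw [hts, mul_one]
  -- Jensen for the tilted probability `exp G / Z`, in which `G` has mean `m`: the exponential is
  -- bounded below by its tangent at `(s / t) * m`.
  have hlow : Z * Real.exp (s / t * m) ≤ ∫ x, Real.exp (G x / t) ∂μ := by
    have h1 : ∫ x, Real.exp (s / t * m) * ((1 - s / t * m) * Real.exp (G x)
        + s / t * (G x * Real.exp (G x))) ∂μ = Z * Real.exp (s / t * m) := by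
      rw [integral_const_mul, integral_add (hi.const_mul _) (hi'.const_mul _),
        integral_const_mul, integral_const_mul, hmZ]
      ring
    rw [← h1]
    refine integral_mono (((hi.const_mul _).add (hi'.const_mul _)).const_mul _)
      (integrable_exp_of_abs_le (B := B / t) (hG.div_const t) fun x => ?_) fun x => ?_
    · rw [abs_div, abs_of_pos ht]
      exact div_le_div_of_nonneg_right (hB x) ht.le
    · have h2 : Real.exp (G x / t)
          = Real.exp (s / t * m) * (Real.exp (G x) * Real.exp (s / t * (G x - m))) := by
        rw [← Real.exp_add, ← Real.exp_add, hst]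
        ring_nf
      simp only
      rw [h2]
      refine mul_le_mul_of_nonneg_left ?_ (Real.exp_pos _).le
      have h3 := mul_le_mul_of_nonneg_left (Real.add_one_le_exp (s / t * (G x - m)))
        (Real.exp_pos (G x)).le
      linarith
  rw [hmZ]
  calc Z + s * (m * Z - Z * Real.log Z) = Z * (s * (m - Real.log Z) + 1) := by ring
    _ ≤ Z * Real.exp (s * (m - Real.log Z)) :=
        mul_le_mul_of_nonneg_left (Real.add_one_le_exp _) hZ0.le
    _ = (Z * Real.exp (s / t * m)) ^ t := by
        rw [Real.mul_rpow hZ0.le (Real.exp_pos _).le, Real.rpow_def_of_pos hZ0, ← Real.exp_mul,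
          ← Real.exp_add]
        nth_rw 1 [← Real.exp_log hZ0]
        rw [← Real.exp_add]
        congr 1
        have : t = 1 - s := by linarith
        field_simp
        rw [this]
        ring
    _ ≤ _ := Real.rpow_le_rpow (by positivity) hlow ht.le

/-- The bound `exp y ≤ 1 + y + y²` for `|y| ≤ 1` makes the error explicitly quadratic in `r`, so it
vanishes in the first-order limit. -/
theorem integral_exp_add_le {Ω : Type*} [MeasurableSpace Ω] {μ : Measure Ω}
    [IsProbabilityMeasure μ] {G K : Ω → ℝ} (hG : Measurable G) {B : ℝ} (hB : ∀ x, |G x| ≤ B)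
    (hK : Measurable K) {B' : ℝ} (hB' : ∀ x, |K x| ≤ B') {r : ℝ} (hr : 0 ≤ r)
    (hr1 : r * B' ≤ 1) :
    ∫ x, Real.exp (G x + r * K x) ∂μ ≤ (∫ x, Real.exp (G x) ∂μ)
      + r * (∫ x, K x * Real.exp (G x) ∂μ) + (r * B') ^ 2 * ∫ x, Real.exp (G x) ∂μ := by
  have hi := integrable_exp_of_abs_le (μ := μ) hG hB
  have hi' := integrable_mul_exp_of_abs_le (μ := μ) hG hB hK hB'
  have hrK : ∀ x, |r * K x| ≤ r * B' := fun x => by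
    rw [abs_mul, abs_of_nonneg hr]
    exact mul_le_mul_of_nonneg_left (hB' x) hr
  have h0 : ∫ x, (Real.exp (G x) + r * (K x * Real.exp (G x)) + (r * B') ^ 2 * Real.exp (G x)) ∂μ
      = (∫ x, Real.exp (G x) ∂μ)
      + r * (∫ x, K x * Real.exp (G x) ∂μ) + (r * B') ^ 2 * ∫ x, Real.exp (G x) ∂μ := by
    have hs : Integrable (fun x => Real.exp (G x) + r * (K x * Real.exp (G x))) μ :=
      hi.add (hi'.const_mul _)
    rw [integral_add hs (hi.const_mul _), integral_add hi (hi'.const_mul _), integral_const_mul, integral_const_mul]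
  rw [← h0]
  refine integral_mono (integrable_exp_of_abs_le (B := B + r * B') (hG.add (hK.const_mul _))
    fun x => (abs_add_le _ _).trans (add_le_add (hB x) (hrK x)))
    ((hi.add (hi'.const_mul _)).add (hi.const_mul _)) fun x => ?_
  have h1 := le_of_abs_le (Real.abs_exp_sub_one_sub_id_le ((hrK x).trans hr1))
  have h2 : (r * K x) ^ 2 ≤ (r * B') ^ 2 := by
    rw [← sq_abs]
    exact pow_le_pow_left₀ (abs_nonneg _) (hrK x) 2
  simp only
  rw [Real.exp_add]
  have h3 := mul_le_mul_of_nonneg_left (h1.trans h2) (Real.exp_pos (G x)).le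
  linarith

theorem lintegral_exp_withDensity {n : ℕ} {V g : EuclideanSpace ℝ (Fin n) → ℝ} (hV : Measurable V)
    (hg : Measurable g) :
    ∫⁻ x, ENNReal.ofReal (Real.exp (g x))
        ∂(volume.withDensity fun x => ENNReal.ofReal (Real.exp (-V x)))
      = ∫⁻ x, ENNReal.ofReal (Real.exp (g x - V x)) := by
  have hVe : Measurable fun x => ENNReal.ofReal (Real.exp (-V x)) := hV.neg.exp.ennreal_ofReal
  rw [lintegral_withDensity_eq_lintegral_mul _ hVe hg.exp.ennreal_ofReal]
  refine lintegral_congr fun x => ?_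
  rw [Pi.mul_apply, ← ENNReal.ofReal_mul (Real.exp_pos _).le, ← Real.exp_add]
  ring_nf

/-- The Prékopa–Leindler inequality for a strongly log-concave probability measure, applied to a
function with a quadratic upper bound around each point. -/
theorem lintegral_exp_div_rpow_le {n : ℕ} {V G : EuclideanSpace ℝ (Fin n) → ℝ}
    {D : EuclideanSpace ℝ (Fin n) → EuclideanSpace ℝ (Fin n)} {c M : ℝ}
    (hV : StrongConvexOn Set.univ c V) (hVm : Measurable V)
    [IsProbabilityMeasure (volume.withDensity fun x => ENNReal.ofReal (Real.exp (-V x)))]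
    (hG : Measurable G) (hD : Measurable D)
    (hGD : ∀ x y, G y ≤ G x + inner ℝ (D x) (y - x) + M / 2 * ‖y - x‖ ^ 2)
    {t s : ℝ} (ht : 0 < t) (hs : 0 < s) (hts : t + s = 1) (hpos : 0 < c * t - M * s) :
    (∫⁻ x, ENNReal.ofReal (Real.exp (G x / t))
        ∂(volume.withDensity fun x => ENNReal.ofReal (Real.exp (-V x)))) ^ t
      ≤ ∫⁻ x, ENNReal.ofReal (Real.exp (G x + s / (2 * (c * t - M * s)) * ‖D x‖ ^ 2))
        ∂(volume.withDensity fun x => ENNReal.ofReal (Real.exp (-V x))) := by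
  have hDm : Measurable fun x => G x + s / (2 * (c * t - M * s)) * ‖D x‖ ^ 2 :=
    hG.add ((hD.norm.pow_const 2).const_mul _)
  have h1 : ∫⁻ x, ENNReal.ofReal (Real.exp (-V x)) = 1 := by
    have := measure_univ (μ := volume.withDensity fun x => ENNReal.ofReal (Real.exp (-V x)))
    rwa [withDensity_apply _ MeasurableSet.univ, Measure.restrict_univ] at this
  rw [lintegral_exp_withDensity hVm (hG.div_const t), lintegral_exp_withDensity hVm hDm]
  have := prekopa_leindler ht hs hts (u := fun x => ENNReal.ofReal (Real.exp (G x / t - V x)))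
    (v := fun x => ENNReal.ofReal (Real.exp (-V x)))
    (w := fun x => ENNReal.ofReal (Real.exp (G x + s / (2 * (c * t - M * s)) * ‖D x‖ ^ 2 - V x)))
    ((hG.div_const t).sub hVm).exp.ennreal_ofReal hVm.neg.exp.ennreal_ofReal
    (hDm.sub hVm).exp.ennreal_ofReal ?_
  · rwa [h1, ENNReal.one_rpow, mul_one] at this
  intro x y
  rw [ENNReal.ofReal_rpow_of_pos (Real.exp_pos _), ENNReal.ofReal_rpow_of_pos (Real.exp_pos _),
    ← ENNReal.ofReal_mul (by positivity), ← Real.exp_mul, ← Real.exp_mul, ← Real.exp_add]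
  refine ENNReal.ofReal_le_ofReal (Real.exp_le_exp.2 ?_)
  set z := t • x + s • y with hz
  have hxz : x - z = s • (x - y) := by
    have : x = (t + s) • x := by rw [hts, one_smul]
    nth_rw 1 [this]
    rw [hz, add_smul, smul_sub]
    abel
  have h2 := hV.2 (Set.mem_univ x) (Set.mem_univ y) ht.le hs.le hts
  simp only [smul_eq_mul] at h2
  have h3 := hGD z x
  rw [hxz, inner_smul_right, norm_smul, Real.norm_of_nonneg hs.le] at h3
  have h4 := real_inner_le_norm (D z) (x - y)
  set k := c * t - M * s with hk
  -- Strong convexity contributes `-t s c / 2 ‖x - y‖²` and the quadratic bound on `G` costs `M s² /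
  -- 2 ‖x - y‖²`; together they leave `-s k / 2 ‖x - y‖²`, and completing the square absorbs the
  -- linear term.
  have h5 : ‖D z‖ * ‖x - y‖ - k / 2 * ‖x - y‖ ^ 2 ≤ 1 / (2 * k) * ‖D z‖ ^ 2 := by
    have h6 : 1 / (2 * k) * ‖D z‖ ^ 2 - (‖D z‖ * ‖x - y‖ - k / 2 * ‖x - y‖ ^ 2)
        = 1 / (2 * k) * (‖D z‖ - k * ‖x - y‖) ^ 2 := by
      field_simp
      ring
    have : 0 ≤ 1 / (2 * k) * (‖D z‖ - k * ‖x - y‖) ^ 2 := by positivity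
    linarith
  have h7 := mul_le_mul_of_nonneg_left (h4.trans (sub_le_iff_le_add.1 h5)) hs.le
  have h8 : (G x / t - V x) * t = G x - t * V x := by field_simp
  rw [h8]
  have h9 : s / (2 * k) * ‖D z‖ ^ 2 = s * (1 / (2 * k) * ‖D z‖ ^ 2) := by ring
  rw [h9]
  have h10 : s * (k / 2 * ‖x - y‖ ^ 2)
      = t * s * (c / 2 * ‖x - y‖ ^ 2) - M / 2 * (s * ‖x - y‖) ^ 2 := by rw [hk]; ring
  linarith

/-- The exponential form of the log-Sobolev inequality for strongly log-concave measures. -/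
theorem entropy_exp_le {n : ℕ} {V G : EuclideanSpace ℝ (Fin n) → ℝ}
    {D : EuclideanSpace ℝ (Fin n) → EuclideanSpace ℝ (Fin n)} {c M B B' : ℝ} (hc : 0 < c)
    (hV : StrongConvexOn Set.univ c V) (hVm : Measurable V)
    {μ : Measure (EuclideanSpace ℝ (Fin n))}
    (hμ : μ = volume.withDensity fun x => ENNReal.ofReal (Real.exp (-V x)))
    [IsProbabilityMeasure μ]
    (hG : Measurable G) (hB : ∀ x, |G x| ≤ B) (hD : Measurable D) (hB' : ∀ x, ‖D x‖ ^ 2 ≤ B')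
    (hGD : ∀ x y, G y ≤ G x + inner ℝ (D x) (y - x) + M / 2 * ‖y - x‖ ^ 2) :
    (∫ x, G x * Real.exp (G x) ∂μ)
      - (∫ x, Real.exp (G x) ∂μ) * Real.log (∫ x, Real.exp (G x) ∂μ)
      ≤ 1 / (2 * c) * ∫ x, ‖D x‖ ^ 2 * Real.exp (G x) ∂μ := by
  have hB'' : ∀ x, |‖D x‖ ^ 2| ≤ B' := fun x => by
    rw [abs_of_nonneg (by positivity)]
    exact hB' x
  have hDm : Measurable fun x => ‖D x‖ ^ 2 := hD.norm.pow_const 2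
  set Z := ∫ x, Real.exp (G x) ∂μ with hZ
  set I := ∫ x, ‖D x‖ ^ 2 * Real.exp (G x) ∂μ with hI
  set H := (∫ x, G x * Real.exp (G x) ∂μ) - Z * Real.log Z with hH
  have hlim : ∀ F : ℝ → ℝ, ContinuousAt F 0 →
      Filter.Tendsto F (nhdsWithin 0 (Set.Ioi 0)) (nhds (F 0)) :=
    fun F hF => hF.mono_left nhdsWithin_le_nhds
  have hk0 : (2 * (c * (1 - 0) - M * 0)) ≠ 0 := by simpa using hc.ne'
  have hcont : ContinuousAt (fun s : ℝ => 1 / (2 * (c * (1 - s) - M * s))) 0 :=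
    ContinuousAt.div (by fun_prop) (by fun_prop) hk0
  -- This is the upper bound for the entropy after division by `s`; at `s = 0` it becomes `I /
  -- (2c)`.
  have hT := hlim (fun s : ℝ => 1 / (2 * (c * (1 - s) - M * s)) * I
    + s * (1 / (2 * (c * (1 - s) - M * s)) * B') ^ 2 * Z) (by fun_prop)
  simp only [sub_zero, mul_one, mul_zero, zero_mul, add_zero] at hT
  refine ge_of_tendsto hT ?_
  have ev1 : ∀ᶠ s : ℝ in nhdsWithin 0 (Set.Ioi 0), 0 < c * (1 - s) - M * s :=
    (hlim (fun s => c * (1 - s) - M * s) (by fun_prop)).eventually_const_lt (by simpa using hc)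
  have ev2 : ∀ᶠ s : ℝ in nhdsWithin 0 (Set.Ioi 0),
      s * (1 / (2 * (c * (1 - s) - M * s))) * B' < 1 :=
    (hlim (fun s => s * (1 / (2 * (c * (1 - s) - M * s))) * B')
      (by fun_prop)).eventually_lt_const (by simp)
  have ev3 : ∀ᶠ s : ℝ in nhdsWithin 0 (Set.Ioi 0), s < 1 :=
    (hlim (fun s => s) (by fun_prop)).eventually_lt_const (by simp)
  filter_upwards [ev1, ev2, ev3, self_mem_nhdsWithin] with s h1 h2 h3 h4
  have hs : 0 < s := h4
  have ht : 0 < 1 - s := by linarith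
  set k := 1 / (2 * (c * (1 - s) - M * s)) with hk
  have hk0 : 0 ≤ k := by positivity
  have hrk : ∀ x, |s * k * ‖D x‖ ^ 2| ≤ s * k * B' := fun x => by
    rw [abs_of_nonneg (by positivity)]
    exact mul_le_mul_of_nonneg_left (hB' x) (by positivity)
  have hpl : (∫ x, Real.exp (G x / (1 - s)) ∂μ) ^ (1 - s)
      ≤ ∫ x, Real.exp (G x + s * k * ‖D x‖ ^ 2) ∂μ := by
    subst hμ
    have := lintegral_exp_div_rpow_le hV hVm hG hD hGD ht hs (by ring) h1
    have hsk : s / (2 * (c * (1 - s) - M * s)) = s * k := by rw [hk]; ring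
    rw [hsk, ← ofReal_integral_eq_lintegral_ofReal, ← ofReal_integral_eq_lintegral_ofReal,
      ENNReal.ofReal_rpow_of_nonneg (integral_nonneg fun x => (Real.exp_pos _).le) ht.le] at this
    · exact (ENNReal.ofReal_le_ofReal_iff (integral_nonneg fun x => (Real.exp_pos _).le)).1 this
    · exact integrable_exp_of_abs_le (B := B + s * k * B') (hG.add (hDm.const_mul _))
        fun x => (abs_add_le _ _).trans (add_le_add (hB x) (hrk x))
    · exact Filter.Eventually.of_forall fun x => (Real.exp_pos _).le
    · refine integrable_exp_of_abs_le (B := B / (1 - s)) (hG.div_const _) fun x => ?_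
      rw [abs_div, abs_of_pos ht]
      exact div_le_div_of_nonneg_right (hB x) ht.le
    · exact Filter.Eventually.of_forall fun x => (Real.exp_pos _).le
  have hlow := integral_exp_add_mul_entropy_le (μ := μ) hG hB ht (s := s) (by ring)
  have hup := integral_exp_add_le (μ := μ) hG hB hDm hB'' (r := s * k) (by positivity) h2.le
  have h5 := (hlow.trans hpl).trans hup
  rw [← hZ, ← hH, ← hI] at h5
  have h6 : s * H ≤ s * (k * I + s * (k * B') ^ 2 * Z) := by linarith
  exact le_of_mul_le_mul_left h6 hs

theorem norm_gradient_eq {F : Type*} [NormedAddCommGroup F] [InnerProductSpace ℝ F]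
    [CompleteSpace F] (g : F → ℝ) (x : F) : ‖gradient g x‖ = ‖fderiv ℝ g x‖ := by
  simp [gradient]

/-- The error in the first-order Taylor expansion of a function with Lipschitz gradient. -/
theorem abs_sub_sub_inner_gradient_le {F : Type*} [NormedAddCommGroup F] [InnerProductSpace ℝ F]
    [CompleteSpace F] {g : F → ℝ} (hg : Differentiable ℝ g) {K : ℝ≥0}
    (hK : LipschitzWith K (gradient g)) (x y : F) :
    |g y - g x - inner ℝ (gradient g x) (y - x)| ≤ K * ‖y - x‖ ^ 2 := by
  -- The mean value inequality on the segment gives the constant `K` instead of the sharp `K / 2`,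
  -- which suffices.
  have h := (convex_segment (𝕜 := ℝ) x y).norm_image_sub_le_of_norm_fderiv_le'
    (f := g) (φ := fderiv ℝ g x) (C := K * ‖y - x‖) (fun z _ => hg z) (fun z hz => ?_)
    (left_mem_segment ℝ x y) (right_mem_segment ℝ x y)
  · have e : fderiv ℝ g x (y - x) = inner ℝ (gradient g x) (y - x) := by
      rw [gradient, InnerProductSpace.toDual_symm_apply]
    rw [e, Real.norm_eq_abs] at h
    rw [sq, ← mul_assoc]
    exact h
  · have e : fderiv ℝ g z - fderiv ℝ g x
        = InnerProductSpace.toDual ℝ F (gradient g z - gradient g x) := by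
      simp [gradient]
    rw [e, LinearIsometryEquiv.norm_map]
    refine (hK.norm_sub_le z x).trans (mul_le_mul_of_nonneg_left ?_ K.2)
    obtain ⟨a, ha, rfl⟩ := (segment_eq_image' ℝ x y ▸ hz : z ∈ (fun θ : ℝ => x + θ • (y - x)) '' _)
    simp only [add_sub_cancel_left, norm_smul, Real.norm_of_nonneg ha.1]
    exact mul_le_of_le_one_left (norm_nonneg _) ha.2

theorem fderiv_log_sq_add {F : Type*} [NormedAddCommGroup F] [NormedSpace ℝ F] {g : F → ℝ} {x : F}
    (hg : DifferentiableAt ℝ g x) {ε : ℝ} (hε : 0 < ε) :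
    fderiv ℝ (fun y => Real.log (g y ^ 2 + ε)) x = (2 * g x / (g x ^ 2 + ε)) • fderiv ℝ g x := by
  have h1 : HasFDerivAt (fun y => g y ^ 2 + ε) ((2 * g x) • fderiv ℝ g x) x := by
    simpa using (hg.hasFDerivAt.pow 2).add_const ε
  have h2 := h1.log (by positivity)
  rw [h2.fderiv, smul_smul]
  congr 1
  ring

theorem sq_mul_le_four_mul {a b ε : ℝ} (hε : 0 < ε) :
    ‖2 * a / (a ^ 2 + ε)‖ ^ 2 * b ^ 2 * (a ^ 2 + ε) ≤ 4 * b ^ 2 := by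
  have h : 0 < a ^ 2 + ε := by positivity
  have e : ‖2 * a / (a ^ 2 + ε)‖ ^ 2 * b ^ 2 * (a ^ 2 + ε)
      = 4 * b ^ 2 * (a ^ 2 / (a ^ 2 + ε)) := by
    rw [Real.norm_eq_abs, sq_abs]
    field_simp
    ring
  rw [e]
  refine mul_le_of_le_one_right (by positivity) ((div_le_one h).2 (by linarith))

/-- The log-Sobolev inequality for strongly log-concave measures and for functions
`g ^ 2 + ε` with `g` smooth of compact support. -/
theorem entropy_sq_add_le {n : ℕ} {V : EuclideanSpace ℝ (Fin n) → ℝ} {c : ℝ} (hc : 0 < c)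
    (hV : StrongConvexOn Set.univ c V) (hVm : Measurable V)
    {μ : Measure (EuclideanSpace ℝ (Fin n))}
    (hμ : μ = volume.withDensity fun x => ENNReal.ofReal (Real.exp (-V x)))
    [IsProbabilityMeasure μ] {g : EuclideanSpace ℝ (Fin n) → ℝ} (hg : ContDiff ℝ ∞ g)
    (hgc : HasCompactSupport g) {ε : ℝ} (hε : 0 < ε) :
    (∫ x, (g x ^ 2 + ε) * Real.log (g x ^ 2 + ε) ∂μ)
      - (∫ x, (g x ^ 2 + ε) ∂μ) * Real.log (∫ x, (g x ^ 2 + ε) ∂μ)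
      ≤ 2 / c * ∫ x, ‖fderiv ℝ g x‖ ^ 2 ∂μ := by
  set G : EuclideanSpace ℝ (Fin n) → ℝ := fun x => Real.log (g x ^ 2 + ε) with hG
  have hpos : ∀ x, 0 < g x ^ 2 + ε := fun x => by positivity
  have hGs : ContDiff ℝ ∞ G := ((hg.pow 2).add contDiff_const).log fun x => (hpos x).ne'
  have hGs' : Differentiable ℝ G := hGs.differentiable (by simp)
  -- Off the support of `g`, `G` is the constant `log ε`; hence `G` is bounded with bounded
  -- Lipschitz gradient.
  have hGc : HasCompactSupport fun x => G x - Real.log ε :=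
    hgc.mono' fun x hx => subset_closure fun h0 => hx (by simp [hG, h0])
  have hfd : fderiv ℝ G = fderiv ℝ fun x => G x - Real.log ε := by
    ext1 x
    rw [fderiv_sub_const]
  have hfc : HasCompactSupport (fderiv ℝ G) := hfd ▸ hGc.fderiv (𝕜 := ℝ)
  have hf1 : ContDiff ℝ 1 (fderiv ℝ G) := hGs.fderiv_right (m := 1) (by norm_cast)
  obtain ⟨K, hK⟩ := hf1.lipschitzWith_of_hasCompactSupport hfc one_ne_zero
  obtain ⟨B', hB'⟩ := hfc.exists_bound_of_continuous hf1.continuous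
  obtain ⟨B, hB⟩ := hGc.exists_bound_of_continuous (hGs.continuous.sub continuous_const)
  have hgK : LipschitzWith K (gradient G) := by
    have := (InnerProductSpace.toDual ℝ (EuclideanSpace ℝ (Fin n))).symm.lipschitz.comp hK
    rwa [one_mul] at this
  have hexp : ∀ x, Real.exp (G x) = g x ^ 2 + ε := fun x => Real.exp_log (hpos x)
  have key := entropy_exp_le (G := G) (D := gradient G) (B := B + |Real.log ε|) (B' := B' ^ 2)
    (M := 2 * K) hc hV hVm hμ hGs.continuous.measurable (fun x => by
      have h1 := hB x
      have h2 := abs_add_le (G x - Real.log ε) (Real.log ε)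
      rw [Real.norm_eq_abs] at h1
      rw [sub_add_cancel] at h2
      linarith) hgK.continuous.measurable (fun x => by
      rw [norm_gradient_eq]
      exact pow_le_pow_left₀ (norm_nonneg _) (hB' x) 2) (fun x y => by
      have := le_of_abs_le (abs_sub_sub_inner_gradient_le hGs' hgK x y)
      linarith)
  simp only [hexp] at key
  have e1 : ∀ x, G x * (g x ^ 2 + ε) = (g x ^ 2 + ε) * Real.log (g x ^ 2 + ε) := fun x =>
    mul_comm _ _
  simp only [e1] at key
  refine key.trans ?_
  have hgd : HasCompactSupport (fderiv ℝ g) := hgc.fderiv (𝕜 := ℝ)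
  have hgdc : Continuous (fderiv ℝ g) := hg.continuous_fderiv (by simp)
  obtain ⟨A, hA⟩ := hgd.exists_bound_of_continuous hgdc
  obtain ⟨A', hA'⟩ := hgc.exists_bound_of_continuous hg.continuous
  have hle : ∫ x, ‖gradient G x‖ ^ 2 * (g x ^ 2 + ε) ∂μ ≤ ∫ x, 4 * ‖fderiv ℝ g x‖ ^ 2 ∂μ := by
    have hp : ∀ x, ‖gradient G x‖ ^ 2 * (g x ^ 2 + ε) ≤ 4 * ‖fderiv ℝ g x‖ ^ 2 := fun x => by
      rw [norm_gradient_eq, hG, fderiv_log_sq_add (hg.differentiable (by simp) x) hε, norm_smul,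
        mul_pow]
      exact sq_mul_le_four_mul hε
    have hi : Integrable (fun x => 4 * ‖fderiv ℝ g x‖ ^ 2) μ :=
      integrable_of_abs_le (hgdc.norm.pow 2 |>.const_mul 4 |>.measurable) (B := 4 * A ^ 2)
        fun x => by
          rw [abs_of_nonneg (by positivity)]
          exact mul_le_mul_of_nonneg_left (pow_le_pow_left₀ (norm_nonneg _) (hA x) 2) (by norm_num)
    exact integral_mono_of_nonneg (Filter.Eventually.of_forall fun x =>
      mul_nonneg (by positivity) (hpos x).le) hi (Filter.Eventually.of_forall hp)
  calc _ ≤ 1 / (2 * c) * ∫ x, 4 * ‖fderiv ℝ g x‖ ^ 2 ∂μ :=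
        mul_le_mul_of_nonneg_left hle (by positivity)
    _ = _ := by
        rw [integral_const_mul]
        field_simp
        ring

/-! ### Removing the compact support assumption. -/

/-- One bump function is dilated by `k + 1`, which divides its derivative by the same factor. -/
theorem exists_cutoff (n : ℕ) : ∃ (χ : ℕ → EuclideanSpace ℝ (Fin n) → ℝ) (C : ℝ), 0 ≤ C ∧
    ∀ k, ContDiff ℝ ∞ (χ k) ∧ HasCompactSupport (χ k) ∧ (∀ x, |χ k x| ≤ 1) ∧
      (∀ x, ‖fderiv ℝ (χ k) x‖ ≤ C / (k + 1)) ∧ ∀ x, ‖x‖ ≤ k + 1 → χ k x = 1 := by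
  let b : ContDiffBump (0 : EuclideanSpace ℝ (Fin n)) := ⟨1, 2, one_pos, one_lt_two⟩
  have hb : ContDiff ℝ ∞ b := b.contDiff
  have hbc : HasCompactSupport b := b.hasCompactSupport
  obtain ⟨C, hC⟩ := (hbc.fderiv (𝕜 := ℝ)).exists_bound_of_continuous
    (hb.continuous_fderiv (by simp))
  refine ⟨fun k x => b ((k + 1 : ℝ)⁻¹ • x), C, (norm_nonneg _).trans (hC 0), fun k => ?_⟩
  have hk : (0 : ℝ) < k + 1 := by positivity
  refine ⟨hb.comp (contDiff_const_smul _), hbc.comp_smul (inv_ne_zero hk.ne'), fun x => ?_,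
    fun x => ?_, fun x hx => ?_⟩
  · rw [abs_of_nonneg b.nonneg]
    exact b.le_one
  · have h1 : HasFDerivAt (fun x => b ((k + 1 : ℝ)⁻¹ • x))
        ((k + 1 : ℝ)⁻¹ • fderiv ℝ b ((k + 1 : ℝ)⁻¹ • x)) x := by
      have h2 := (hb.differentiable (by simp) ((k + 1 : ℝ)⁻¹ • x)).hasFDerivAt
      have h3 := h2.comp x ((hasFDerivAt_id x).const_smul (k + 1 : ℝ)⁻¹)
      exact h3.congr_fderiv (by ext v; simp)
    rw [h1.fderiv, norm_smul, Real.norm_of_nonneg (by positivity), div_eq_inv_mul]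
    exact mul_le_mul_of_nonneg_left (hC _) (by positivity)
  · refine b.one_of_mem_closedBall ?_
    rw [mem_closedBall_zero_iff, norm_smul, Real.norm_of_nonneg (by positivity), inv_mul_le_iff₀ hk]
    simpa [b] using hx

/-- This is `log y ≤ y - 1` at `y = c / u`. Integrated in `u`, the expression equals the entropy
when `c` is the mean and exceeds it otherwise. Its sign permits Fatou's lemma and comparison of
measures. -/
theorem Real.mul_log_sub_mul_log_nonneg {u c : ℝ} (hu : 0 ≤ u) (hc : 0 < c) :
    0 ≤ u * Real.log u - u * Real.log c - u + c := by
  rcases hu.eq_or_lt with rfl | hu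
  · simpa using hc.le
  · have h1 := Real.log_le_sub_one_of_pos (div_pos hc hu)
    rw [Real.log_div hc.ne' hu.ne'] at h1
    have h2 := mul_le_mul_of_nonneg_left h1 hu.le
    have h3 : u * (c / u - 1) = c - u := by field_simp
    linarith

/-- The log-Sobolev inequality extends from smooth functions of compact support to all smooth
functions. -/
theorem ReverseDiffusion.satisfiesLSI_of_hasCompactSupport {d : ℕ}
    {μ : Measure (ReverseDiffusion.E d)} [IsProbabilityMeasure μ] {c : ℝ} (hc : 0 < c)
    (h : ∀ g : ReverseDiffusion.E d → ℝ, ContDiff ℝ ∞ g → HasCompactSupport g → ∀ ε : ℝ, 0 < ε →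
      (∫ x, (g x ^ 2 + ε) * Real.log (g x ^ 2 + ε) ∂μ)
      - (∫ x, (g x ^ 2 + ε) ∂μ) * Real.log (∫ x, (g x ^ 2 + ε) ∂μ)
      ≤ 2 / c * ∫ x, ‖fderiv ℝ g x‖ ^ 2 ∂μ) :
    ReverseDiffusion.SatisfiesLSI μ c := by
  refine ⟨inferInstance, hc, fun g hg hg2 hgd => ?_⟩
  simp only [norm_gradient_eq] at hgd ⊢
  set m := ∫ x, g x ^ 2 ∂μ with hm
  have hm1 : 0 ≤ m := integral_nonneg fun x => sq_nonneg (g x)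
  rcases hm1.eq_or_lt with hm0 | hm0
  · have h0 := (integral_eq_zero_iff_of_nonneg (fun x => sq_nonneg (g x)) hg2).1 hm0.symm
    have h1 : (fun x => g x ^ 2 * Real.log (g x ^ 2)) =ᵐ[μ] 0 := by
      filter_upwards [h0] with x hx
      simp only [Pi.zero_apply] at hx ⊢
      rw [hx, zero_mul]
    refine ⟨(integrable_zero _ _ _).congr h1.symm, ?_⟩
    rw [integral_congr_ae h1, ← hm0]
    simp only [Pi.zero_apply, integral_zero, zero_mul, sub_zero]
    positivity
  obtain ⟨χ, C, hC, hχ⟩ := exists_cutoff d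
  choose hχs hχc hχ1 hχd hχe using hχ
  have hχev : ∀ x, ∀ᶠ k in Filter.atTop, χ k x = 1 := fun x => by
    obtain ⟨N, hN⟩ := exists_nat_ge ‖x‖
    filter_upwards [Filter.eventually_ge_atTop N] with k hk
    have : (N : ℝ) ≤ k := by exact_mod_cast hk
    exact hχe k x (by linarith)
  set ε : ℕ → ℝ := fun k => 1 / ((k : ℝ) + 1) with hε
  have hε0 : ∀ k, 0 < ε k := fun k => by positivity
  have hεt : Filter.Tendsto ε Filter.atTop (nhds 0) := tendsto_one_div_add_atTop_nhds_zero_nat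
  set G : ℕ → ReverseDiffusion.E d → ℝ := fun k x => χ k x * g x with hG
  have hGs : ∀ k, ContDiff ℝ ∞ (G k) := fun k => (hχs k).mul hg
  have hGc : ∀ k, HasCompactSupport (G k) := fun k => (hχc k).mul_right
  have hGle : ∀ k x, G k x ^ 2 ≤ g x ^ 2 := fun k x => by
    simp only [hG, mul_pow]
    refine mul_le_of_le_one_left (sq_nonneg _) ?_
    rw [← sq_abs]
    exact pow_le_one₀ (abs_nonneg _) (hχ1 k x)
  have hGt : ∀ x, Filter.Tendsto (fun k => G k x ^ 2) Filter.atTop (nhds (g x ^ 2)) := fun x => by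
    refine tendsto_const_nhds.congr' ?_
    filter_upwards [hχev x] with k hk
    simp [hG, hk]
  have hGi : ∀ k, Integrable (fun x => G k x ^ 2) μ := fun k =>
    hg2.mono' ((hGs k).continuous.pow 2).aestronglyMeasurable
      (Filter.Eventually.of_forall fun x => by
        rw [Real.norm_of_nonneg (sq_nonneg _)]; exact hGle k x)
  set u : ℕ → ReverseDiffusion.E d → ℝ := fun k x => G k x ^ 2 + ε k with hu
  have hupos : ∀ k x, 0 < u k x := fun k x => add_pos_of_nonneg_of_pos (sq_nonneg _) (hε0 k)
  have huc : ∀ k, Continuous (u k) := fun k => ((hGs k).continuous.pow 2).add continuous_const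
  have hui : ∀ k, Integrable (u k) μ := fun k => (hGi k).add (integrable_const _)
  set a : ℕ → ℝ := fun k => ∫ x, u k x ∂μ with ha
  have haeq : ∀ k, a k = (∫ x, G k x ^ 2 ∂μ) + ε k := fun k => by
    simp only [ha, hu]
    rw [integral_add (hGi k) (integrable_const _)]
    simp
  have hapos : ∀ k, 0 < a k := fun k => by
    rw [haeq]
    exact add_pos_of_nonneg_of_pos (integral_nonneg fun x => sq_nonneg _) (hε0 k)
  have hat : Filter.Tendsto a Filter.atTop (nhds m) := by
    have h1 : Filter.Tendsto (fun k => ∫ x, G k x ^ 2 ∂μ) Filter.atTop (nhds m) :=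
      tendsto_integral_of_dominated_convergence (fun x => g x ^ 2)
        (fun k => (hGi k).aestronglyMeasurable) hg2
        (fun k => Filter.Eventually.of_forall fun x => by
          rw [Real.norm_of_nonneg (sq_nonneg _)]; exact hGle k x)
        (Filter.Eventually.of_forall hGt)
    have h2 := h1.add hεt
    rw [add_zero] at h2
    exact h2.congr fun k => (haeq k).symm
  have hfd : ∀ k x, fderiv ℝ (G k) x = χ k x • fderiv ℝ g x + g x • fderiv ℝ (χ k) x :=
    fun k x => fderiv_fun_mul ((hχs k).differentiable (by simp) x) (hg.differentiable (by simp) x)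
  have hgdc : Continuous (fderiv ℝ g) := hg.continuous_fderiv (by simp)
  have hbt : Filter.Tendsto (fun k => ∫ x, ‖fderiv ℝ (G k) x‖ ^ 2 ∂μ) Filter.atTop
      (nhds (∫ x, ‖fderiv ℝ g x‖ ^ 2 ∂μ)) := by
    refine tendsto_integral_of_dominated_convergence
      (fun x => 2 * ‖fderiv ℝ g x‖ ^ 2 + 2 * C ^ 2 * g x ^ 2)
      (fun k => (((hGs k).continuous_fderiv (by simp)).norm.pow 2).aestronglyMeasurable)
      ((hgd.const_mul _).add (hg2.const_mul _))
      (fun k => Filter.Eventually.of_forall fun x => ?_) (Filter.Eventually.of_forall fun x => ?_)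
    · rw [Real.norm_of_nonneg (by positivity), hfd]
      have h1 : ‖χ k x • fderiv ℝ g x + g x • fderiv ℝ (χ k) x‖
          ≤ ‖fderiv ℝ g x‖ + C * |g x| := by
        refine (norm_add_le _ _).trans (add_le_add ?_ ?_)
        · rw [norm_smul]
          exact mul_le_of_le_one_left (norm_nonneg _) (hχ1 k x)
        · rw [norm_smul, mul_comm, Real.norm_eq_abs]
          refine mul_le_mul_of_nonneg_right ((hχd k x).trans ?_) (abs_nonneg _)
          exact div_le_self hC (by linarith [(Nat.cast_nonneg k : (0 : ℝ) ≤ k)])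
      have h2 := pow_le_pow_left₀ (norm_nonneg _) h1 2
      have h3 : (C * |g x|) ^ 2 = C ^ 2 * g x ^ 2 := by rw [mul_pow, sq_abs]
      -- Here `(a + b)² ≤ 2a² + 2b²`.
      linarith [sq_nonneg (‖fderiv ℝ g x‖ - C * |g x|)]
    · refine Filter.Tendsto.pow (Filter.Tendsto.norm ?_) 2
      have h1 : Filter.Tendsto (fun k => fderiv ℝ (χ k) x) Filter.atTop (nhds 0) := by
        refine squeeze_zero_norm (fun k => hχd k x) ?_
        have := hεt.const_mul C
        rw [mul_zero] at this
        exact this.congr fun k => by simp only [hε]; ring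
      have h2 : Filter.Tendsto (fun k => χ k x) Filter.atTop (nhds 1) :=
        tendsto_const_nhds.congr' ((hχev x).mono fun k hk => hk.symm)
      have h3 := (h2.smul_const (fderiv ℝ g x)).add (h1.const_smul (g x))
      rw [one_smul, smul_zero, add_zero] at h3
      exact h3.congr fun k => (hfd k x).symm
  set F : ℕ → ReverseDiffusion.E d → ℝ := fun k x =>
    u k x * Real.log (u k x) - u k x * Real.log (a k) - u k x + a k with hF
  set F' : ReverseDiffusion.E d → ℝ := fun x =>
    g x ^ 2 * Real.log (g x ^ 2) - g x ^ 2 * Real.log m - g x ^ 2 + m with hF'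
  have hF0 : ∀ k x, 0 ≤ F k x := fun k x => Real.mul_log_sub_mul_log_nonneg (hupos k x).le (hapos k)
  have hF'0 : ∀ x, 0 ≤ F' x := fun x => Real.mul_log_sub_mul_log_nonneg (sq_nonneg _) hm0
  have hulc : ∀ k, Continuous fun x => u k x * Real.log (u k x) := fun k =>
    Real.continuous_mul_log.comp (huc k)
  have hFc : ∀ k, Continuous (F k) := fun k =>
    (((hulc k).sub ((huc k).mul continuous_const)).sub (huc k)).add continuous_const
  have hF'c : Continuous F' := by
    have h1 : Continuous fun x => g x ^ 2 := hg.continuous.pow 2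
    exact (((Real.continuous_mul_log.comp h1).sub (h1.mul continuous_const)).sub h1).add
      continuous_const
  have hFt : ∀ x, Filter.Tendsto (fun k => F k x) Filter.atTop (nhds (F' x)) := fun x => by
    have h1 : Filter.Tendsto (fun k => u k x) Filter.atTop (nhds (g x ^ 2)) := by
      simpa using (hGt x).add hεt
    exact ((((Real.continuous_mul_log.tendsto _).comp h1).sub
      (h1.mul ((Real.continuousAt_log hm0.ne').tendsto.comp hat))).sub h1).add hat
  have huli : ∀ k, Integrable (fun x => u k x * Real.log (u k x)) μ := fun k => by
    have hsupp : HasCompactSupport fun x => u k x * Real.log (u k x) - ε k * Real.log (ε k) :=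
      (hGc k).mono' fun x hx => subset_closure fun h0 => hx (by simp [hu, h0])
    obtain ⟨B, hB⟩ := hsupp.exists_bound_of_continuous ((hulc k).sub continuous_const)
    have h1 := (integrable_of_abs_le (μ := μ) ((hulc k).sub continuous_const).measurable hB).add
      (integrable_const (ε k * Real.log (ε k)))
    exact h1.congr (Filter.Eventually.of_forall fun x => sub_add_cancel _ _)
  have hFi : ∀ k, Integrable (F k) μ := fun k =>
    (((huli k).sub ((hui k).mul_const _)).sub (hui k)).add (integrable_const _)
  have hFle : ∀ k, ∫ x, F k x ∂μ ≤ 2 / c * ∫ x, ‖fderiv ℝ (G k) x‖ ^ 2 ∂μ := fun k => by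
    refine le_trans (le_of_eq ?_) (h (G k) (hGs k) (hGc k) (ε k) (hε0 k))
    have i1 : Integrable (fun x => u k x * Real.log (u k x) - u k x * Real.log (a k)) μ :=
      (huli k).sub ((hui k).mul_const _)
    have i2 : Integrable
        (fun x => u k x * Real.log (u k x) - u k x * Real.log (a k) - u k x) μ := i1.sub (hui k)
    simp only [hF]
    rw [integral_add i2 (integrable_const _), integral_sub i1 (hui k),
      integral_sub (huli k) ((hui k).mul_const _), integral_mul_const]
    simp [ha]
    rfl
  -- Fatou's lemma for the nonnegative entropy integrands yields both the integrability of `g² log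
  -- g²` and the inequality.
  have hfatou : ∫⁻ x, ENNReal.ofReal (F' x) ∂μ
      ≤ ENNReal.ofReal (2 / c * ∫ x, ‖fderiv ℝ g x‖ ^ 2 ∂μ) := by
    have h1 : ∀ x, ENNReal.ofReal (F' x)
        = Filter.liminf (fun k => ENNReal.ofReal (F k x)) Filter.atTop := fun x =>
      (ENNReal.tendsto_ofReal (hFt x)).liminf_eq.symm
    simp only [h1]
    refine (lintegral_liminf_le fun k => (hFc k).measurable.ennreal_ofReal).trans ?_
    rw [← (ENNReal.tendsto_ofReal (hbt.const_mul (2 / c))).liminf_eq]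
    refine Filter.liminf_le_liminf (Filter.Eventually.of_forall fun k => ?_)
    rw [← ofReal_integral_eq_lintegral_ofReal (hFi k) (Filter.Eventually.of_forall (hF0 k))]
    exact ENNReal.ofReal_le_ofReal (hFle k)
  have hF'i : Integrable F' μ := by
    refine ⟨hF'c.aestronglyMeasurable, ?_⟩
    rw [hasFiniteIntegral_iff_ofReal (Filter.Eventually.of_forall hF'0)]
    exact hfatou.trans_lt ENNReal.ofReal_lt_top
  have hF'le : ∫ x, F' x ∂μ ≤ 2 / c * ∫ x, ‖fderiv ℝ g x‖ ^ 2 ∂μ := by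
    rw [← ofReal_integral_eq_lintegral_ofReal hF'i (Filter.Eventually.of_forall hF'0)] at hfatou
    exact (ENNReal.ofReal_le_ofReal_iff (by positivity)).1 hfatou
  have hsum : ∀ x, F' x + (Real.log m + 1) * g x ^ 2 - m = g x ^ 2 * Real.log (g x ^ 2) :=
    fun x => by simp only [hF']; ring
  have j1 : Integrable (fun x => F' x + (Real.log m + 1) * g x ^ 2) μ :=
    hF'i.add (hg2.const_mul _)
  refine ⟨(j1.sub (integrable_const m)).congr (Filter.Eventually.of_forall hsum), ?_⟩
  simp only [← hsum]
  rw [integral_sub j1 (integrable_const _), integral_add hF'i (hg2.const_mul _),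
    integral_const_mul, ← hm]
  simp only [integral_const, probReal_univ, smul_eq_mul, one_mul]
  linarith

/-- Strongly log-concave probability measures satisfy the log-Sobolev inequality. -/
theorem ReverseDiffusion.satisfiesLSI_of_strongConvexOn {d : ℕ} {V : ReverseDiffusion.E d → ℝ}
    {c : ℝ} (hc : 0 < c) (hV : StrongConvexOn Set.univ c V) (hVm : Measurable V)
    {μ : Measure (ReverseDiffusion.E d)}
    (hμ : μ = volume.withDensity fun x => ENNReal.ofReal (Real.exp (-V x)))
    [IsProbabilityMeasure μ] : ReverseDiffusion.SatisfiesLSI μ c :=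
  ReverseDiffusion.satisfiesLSI_of_hasCompactSupport hc fun _ hg hgc _ hε =>
    entropy_sq_add_le hc hV hVm hμ hg hgc hε

/-! ### Bounded perturbations of Gibbs measures. -/

namespace ReverseDiffusion

theorem SatisfiesLSI.mono {d : ℕ} {ν : Measure (E d)} {μ μ' : ℝ} (h : SatisfiesLSI ν μ)
    (hμ' : 0 < μ') (hle : μ' ≤ μ) : SatisfiesLSI ν μ' := by
  refine ⟨h.1, hμ', fun g hg hg2 hgd => ⟨(h.2.2 g hg hg2 hgd).1, ?_⟩⟩
  refine (h.2.2 g hg hg2 hgd).2.trans ?_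
  refine mul_le_mul_of_nonneg_right ?_ (integral_nonneg fun x => sq_nonneg _)
  exact div_le_div_of_nonneg_left (by norm_num) hμ' hle

theorem satisfiesLSI_dirac {d : ℕ} (x : E d) {μ : ℝ} (hμ : 0 < μ) :
    SatisfiesLSI (Measure.dirac x) μ := by
  refine ⟨inferInstance, hμ, fun g _ _ _ => ⟨integrable_dirac enorm_lt_top, ?_⟩⟩
  rw [integral_dirac, integral_dirac, integral_dirac, sub_self]
  positivity

/-- The Holley–Stroock perturbation principle. -/
theorem SatisfiesLSI.of_le_smul {d : ℕ} {ν ν' : Measure (E d)} [IsProbabilityMeasure ν] {μ A B : ℝ}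
    (h : SatisfiesLSI ν' μ) (hA : 0 < A) (hB : 0 < B) (hνA : ν ≤ ENNReal.ofReal A • ν')
    (hνB : ν' ≤ ENNReal.ofReal B • ν) : SatisfiesLSI ν (μ / (A * B)) := by
  obtain ⟨hp, hμ, h⟩ := h
  refine ⟨inferInstance, by positivity, fun g hg hg2 hgd => ?_⟩
  have to' : ∀ {k : E d → ℝ}, Integrable k ν → Integrable k ν' := fun hk =>
    (hk.smul_measure ENNReal.ofReal_ne_top).mono_measure hνB
  have from' : ∀ {k : E d → ℝ}, Integrable k ν' → Integrable k ν := fun hk =>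
    (hk.smul_measure ENNReal.ofReal_ne_top).mono_measure hνA
  have leA : ∀ {k : E d → ℝ}, (∀ x, 0 ≤ k x) → Integrable k ν' →
      ∫ x, k x ∂ν ≤ A * ∫ x, k x ∂ν' := fun hk0 hk => by
    have := integral_mono_measure hνA (Filter.Eventually.of_forall hk0)
      (hk.smul_measure ENNReal.ofReal_ne_top)
    rwa [integral_smul_measure, ENNReal.toReal_ofReal hA.le, smul_eq_mul] at this
  have leB : ∀ {k : E d → ℝ}, (∀ x, 0 ≤ k x) → Integrable k ν →
      ∫ x, k x ∂ν' ≤ B * ∫ x, k x ∂ν := fun hk0 hk => by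
    have := integral_mono_measure hνB (Filter.Eventually.of_forall hk0)
      (hk.smul_measure ENNReal.ofReal_ne_top)
    rwa [integral_smul_measure, ENNReal.toReal_ofReal hB.le, smul_eq_mul] at this
  obtain ⟨hi, hle⟩ := h g hg (to' hg2) (to' hgd)
  refine ⟨from' hi, ?_⟩
  set c := ∫ x, g x ^ 2 ∂ν' with hc
  set m := ∫ x, g x ^ 2 ∂ν with hm
  set I := ∫ x, ‖gradient g x‖ ^ 2 ∂ν with hI
  set I' := ∫ x, ‖gradient g x‖ ^ 2 ∂ν' with hI'
  have hI0 : 0 ≤ I := integral_nonneg fun x => sq_nonneg _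
  have hc0 : 0 ≤ c := integral_nonneg fun x => sq_nonneg _
  have hm0 : 0 ≤ m := integral_nonneg fun x => sq_nonneg _
  rcases hc0.eq_or_lt with hc0 | hc0
  · have hm1 : m ≤ A * c := leA (fun x => sq_nonneg _) (to' hg2)
    have hm2 : m = 0 := by
      rw [← hc0, mul_zero] at hm1
      exact le_antisymm hm1 hm0
    have h0 := (integral_eq_zero_iff_of_nonneg (fun x => sq_nonneg (g x)) hg2).1 hm2
    have h1 : (fun x => g x ^ 2 * Real.log (g x ^ 2)) =ᵐ[ν] 0 := by
      filter_upwards [h0] with x hx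
      simp only [Pi.zero_apply] at hx ⊢
      rw [hx, zero_mul]
    rw [integral_congr_ae h1, hm2]
    simp only [Pi.zero_apply, integral_zero, zero_mul, sub_zero]
    positivity
  have hF0 : ∀ x, 0 ≤ g x ^ 2 * Real.log (g x ^ 2) - g x ^ 2 * Real.log c - g x ^ 2 + c :=
    fun x => Real.mul_log_sub_mul_log_nonneg (sq_nonneg _) hc0
  have hint : ∀ (ρ : Measure (E d)) [IsProbabilityMeasure ρ], Integrable (fun x => g x ^ 2) ρ →
      Integrable (fun x => g x ^ 2 * Real.log (g x ^ 2)) ρ →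
      Integrable (fun x => g x ^ 2 * Real.log (g x ^ 2) - g x ^ 2 * Real.log c - g x ^ 2 + c) ρ ∧
      ∫ x, (g x ^ 2 * Real.log (g x ^ 2) - g x ^ 2 * Real.log c - g x ^ 2 + c) ∂ρ
        = (∫ x, g x ^ 2 * Real.log (g x ^ 2) ∂ρ) - (∫ x, g x ^ 2 ∂ρ) * Real.log c
          - (∫ x, g x ^ 2 ∂ρ) + c := by
    intro ρ _ h2 h3
    have i1 : Integrable (fun x => g x ^ 2 * Real.log (g x ^ 2) - g x ^ 2 * Real.log c) ρ :=
      h3.sub (h2.mul_const _)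
    have i2 : Integrable
        (fun x => g x ^ 2 * Real.log (g x ^ 2) - g x ^ 2 * Real.log c - g x ^ 2) ρ := i1.sub h2
    refine ⟨i2.add (integrable_const _), ?_⟩
    rw [integral_add i2 (integrable_const _), integral_sub i1 h2, integral_sub h3 (h2.mul_const _),
      integral_mul_const]
    simp
  obtain ⟨_, e1⟩ := hint ν hg2 (from' hi)
  obtain ⟨j2, e2⟩ := hint ν' (to' hg2) hi
  rw [← hm] at e1
  rw [← hc] at e2
  have h3 := leA hF0 j2
  rw [e1, e2] at h3
  -- Using the `ν'`-mean `c` in place of the `ν`-mean `m` only increases the entropy functional of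
  -- `ν`.
  have h4 := Real.mul_log_sub_mul_log_nonneg hm0 hc0
  have h5 : I' ≤ B * I := leB (fun x => sq_nonneg _) hgd
  have h6 : 2 / μ * I' ≤ 2 / μ * (B * I) := mul_le_mul_of_nonneg_left h5 (by positivity)
  have h7 := mul_le_mul_of_nonneg_left (hle.trans h6) hA.le
  have h8 : A * (2 / μ * (B * I)) = 2 / (μ / (A * B)) * I := by field_simp
  rw [← h8]
  linarith

/-- The probability measure with density proportional to `exp (-V)`. -/
def gibbs {d : ℕ} (V : E d → ℝ) : Measure (E d) :=
  volume.withDensity fun x => ENNReal.ofReal (Real.exp (-V x) / ∫ y, Real.exp (-V y))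

theorem isProbabilityMeasure_gibbs {d : ℕ} {V : E d → ℝ}
    (hV : Integrable fun x => Real.exp (-V x)) : IsProbabilityMeasure (gibbs V) := by
  refine ⟨?_⟩
  rw [gibbs, withDensity_apply _ MeasurableSet.univ, Measure.restrict_univ,
    ← ofReal_integral_eq_lintegral_ofReal (hV.div_const _) (Filter.Eventually.of_forall fun x =>
      div_nonneg (Real.exp_pos _).le (integral_nonneg fun y => (Real.exp_pos _).le)),
    integral_div, div_self (integral_exp_pos hV).ne', ENNReal.ofReal_one]

/-- The ratio of normalizing constants is kept exact: it cancels when the bounds in both directions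
are multiplied, leaving `exp (α + β)`. -/
theorem gibbs_le_smul {d : ℕ} {V W : E d → ℝ} (hV : Integrable fun x => Real.exp (-V x))
    (hW : Integrable fun x => Real.exp (-W x)) (hWm : Measurable W) {β : ℝ}
    (h : ∀ x, W x ≤ V x + β) :
    gibbs V ≤ ENNReal.ofReal
      (Real.exp β * (∫ x, Real.exp (-W x)) / ∫ x, Real.exp (-V x)) • gibbs W := by
  have hZ := integral_exp_pos hV
  have hZ' := integral_exp_pos hW
  have hm : Measurable fun x => ENNReal.ofReal (Real.exp (-W x) / ∫ y, Real.exp (-W y)) :=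
    (hWm.neg.exp.div_const _).ennreal_ofReal
  rw [gibbs, gibbs, ← withDensity_smul _ hm]
  refine withDensity_mono (Filter.Eventually.of_forall fun x => ?_)
  rw [Pi.smul_apply, smul_eq_mul, ← ENNReal.ofReal_mul (by positivity)]
  refine ENNReal.ofReal_le_ofReal ?_
  have e : Real.exp β * (∫ x, Real.exp (-W x)) / (∫ x, Real.exp (-V x))
      * (Real.exp (-W x) / ∫ y, Real.exp (-W y))
      = Real.exp β * Real.exp (-W x) / ∫ x, Real.exp (-V x) := by
    field_simp
  rw [e]
  refine div_le_div_of_nonneg_right ?_ hZ.le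
  rw [← Real.exp_add]
  exact Real.exp_le_exp.2 (by linarith [h x])

theorem _root_.StrongConvexOn.add_const {F : Type*} [NormedAddCommGroup F] [NormedSpace ℝ F]
    {s : Set F} {c : ℝ} {V : F → ℝ} (hV : StrongConvexOn s c V) (k : ℝ) :
    StrongConvexOn s c fun x => V x + k := by
  refine ⟨hV.1, fun x hx y hy a b ha hb hab => ?_⟩
  have h := hV.2 hx hy ha hb hab
  simp only [smul_eq_mul] at h ⊢
  have h2 : a * (V x + k) + b * (V y + k) = a * V x + b * V y + k := by
    linear_combination k * hab
  linarith

theorem satisfiesLSI_gibbs {d : ℕ} {W : E d → ℝ} (hW : Integrable fun x => Real.exp (-W x))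
    (hWm : Measurable W) {c : ℝ} (hc : 0 < c) (h : StrongConvexOn Set.univ c W) :
    SatisfiesLSI (gibbs W) c := by
  have := isProbabilityMeasure_gibbs hW
  have hZ := integral_exp_pos hW
  -- The normalizing constant is absorbed into the potential.
  refine satisfiesLSI_of_strongConvexOn hc (h.add_const (Real.log (∫ x, Real.exp (-W x))))
    (hWm.add_const _) ?_
  simp only [gibbs, neg_add, Real.exp_add, Real.exp_neg (Real.log _), Real.exp_log hZ,
    div_eq_mul_inv]

/-- The log-Sobolev inequality for bounded perturbations of strongly convex potentials. -/
theorem satisfiesLSI_gibbs_of_le {d : ℕ} {V W : E d → ℝ} (hV : Integrable fun x => Real.exp (-V x))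
    (hVm : Measurable V) (hWm : Measurable W) {c α β : ℝ} (hc : 0 < c)
    (h : StrongConvexOn Set.univ c W) (hβ : ∀ x, W x ≤ V x + β) (hα : ∀ x, V x ≤ W x + α) :
    SatisfiesLSI (gibbs V) (c * Real.exp (-(α + β))) := by
  have hW : Integrable fun x => Real.exp (-W x) := by
    refine (hV.const_mul (Real.exp α)).mono' hWm.neg.exp.aestronglyMeasurable
      (Filter.Eventually.of_forall fun x => ?_)
    rw [Real.norm_of_nonneg (Real.exp_pos _).le, ← Real.exp_add]
    exact Real.exp_le_exp.2 (by linarith [hα x])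
  have hZ := integral_exp_pos hV
  have hZ' := integral_exp_pos hW
  have := isProbabilityMeasure_gibbs hV
  have key := (satisfiesLSI_gibbs hW hWm hc h).of_le_smul (ν := gibbs V) (by positivity)
    (by positivity) (gibbs_le_smul hV hW hWm hβ) (gibbs_le_smul hW hV hVm hα)
  convert key using 1
  rw [Real.exp_neg, Real.exp_add]
  field_simp

end ReverseDiffusion

/-! ### Convexification of a function that is convex outside a ball. -/

section Convexification

variable {F : Type*} [NormedAddCommGroup F] [InnerProductSpace ℝ F] [CompleteSpace F]

/-- The tangent at `z` to the graph of `f + r ‖·‖ ^ 2`, as a function of `x`. -/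
def tangentAt (f : F → ℝ) (r : ℝ) (z x : F) : ℝ :=
  f z + r * ‖z‖ ^ 2 + inner ℝ (gradient f z + (2 * r) • z) (x - z)

theorem tangentAt_combo (f : F → ℝ) (r : ℝ) (z x y : F) {a b : ℝ} (hab : a + b = 1) :
    tangentAt f r z (a • x + b • y) = a * tangentAt f r z x + b * tangentAt f r z y := by
  have e : a • x + b • y - z = a • (x - z) + b • (y - z) := by
    have : z = (a + b) • z := by rw [hab, one_smul]
    nth_rw 1 [this]
    rw [add_smul, smul_sub, smul_sub]
    abel
  rw [tangentAt, tangentAt, tangentAt, e, inner_add_right, inner_smul_right, inner_smul_right]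
  linear_combination (-(f z + r * ‖z‖ ^ 2)) * hab

theorem tangentAt_self (f : F → ℝ) (r : ℝ) (z : F) :
    tangentAt f r z z = f z + r * ‖z‖ ^ 2 := by
  simp [tangentAt]

variable {f : F → ℝ} {r : ℝ} {L : ℝ≥0}

/-- The quadratic term has the exact remainder `r‖x - z‖²`, so only the Taylor remainder of `f` is
estimated. -/
theorem abs_sub_tangentAt_le (hf : Differentiable ℝ f) (hL : LipschitzWith L (gradient f))
    (z x : F) :
    |f x + r * ‖x‖ ^ 2 - tangentAt f r z x - r * ‖x - z‖ ^ 2| ≤ L * ‖x - z‖ ^ 2 := by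
  have h := abs_sub_sub_inner_gradient_le hf hL z x
  have e : ‖x‖ ^ 2 = ‖z‖ ^ 2 + 2 * inner ℝ z (x - z) + ‖x - z‖ ^ 2 := by
    have := norm_add_sq_real z (x - z)
    rwa [add_sub_cancel] at this
  have e2 : f x + r * ‖x‖ ^ 2 - tangentAt f r z x - r * ‖x - z‖ ^ 2
      = f x - f z - inner ℝ (gradient f z) (x - z) := by
    rw [tangentAt, inner_add_left, real_inner_smul_left, e]
    ring
  rwa [e2]

theorem convexOn_of_tangentAt_le
    (h : ∀ z x, tangentAt f r z x ≤ f x + r * ‖x‖ ^ 2) :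
    ConvexOn ℝ Set.univ fun x => f x + r * ‖x‖ ^ 2 := by
  refine ⟨convex_univ, fun x _ y _ a b ha hb hab => ?_⟩
  have h1 := tangentAt_self f r (a • x + b • y)
  rw [tangentAt_combo _ _ _ _ _ hab] at h1
  simp only [smul_eq_mul]
  rw [← h1]
  exact add_le_add (mul_le_mul_of_nonneg_left (h _ x) ha) (mul_le_mul_of_nonneg_left (h _ y) hb)

/-- The segment from `z` to `y` may cross the ball, but convexity is needed only at its endpoints
and at points near `z`, which stay outside because `ρ < ‖z‖`. Letting these points tend to `z` gives
the tangent inequality. -/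
theorem tangentAt_le_of_convex_outside (hf : Differentiable ℝ f)
    (hL : LipschitzWith L (gradient f)) (hr : 0 ≤ r) {ρ : ℝ}
    (hconv : ∀ x y : F, ∀ a b : ℝ, 0 ≤ a → 0 ≤ b → a + b = 1 → ρ ≤ ‖x‖ → ρ ≤ ‖y‖ →
      ρ ≤ ‖a • x + b • y‖ → f (a • x + b • y) + r * ‖a • x + b • y‖ ^ 2
        ≤ a * (f x + r * ‖x‖ ^ 2) + b * (f y + r * ‖y‖ ^ 2))
    {z y : F} (hz : ρ < ‖z‖) (hy : ρ ≤ ‖y‖) : tangentAt f r z y ≤ f y + r * ‖y‖ ^ 2 := by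
  have hlim : ∀ G : ℝ → ℝ, Continuous G →
      Filter.Tendsto G (nhdsWithin 0 (Set.Ioi 0)) (nhds (G 0)) :=
    fun G hG => (hG.tendsto 0).mono_left nhdsWithin_le_nhds
  have hT := hlim (fun ε => f y + r * ‖y‖ ^ 2 + ε * (L * ‖y - z‖ ^ 2)) (by fun_prop)
  simp only [zero_mul, add_zero] at hT
  refine ge_of_tendsto hT ?_
  have ev1 : ∀ᶠ ε : ℝ in nhdsWithin 0 (Set.Ioi 0), ρ < ‖(1 - ε) • z + ε • y‖ :=
    (hlim (fun ε => ‖(1 - ε) • z + ε • y‖) (by fun_prop)).eventually_const_lt (by simpa using hz)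
  have ev2 : ∀ᶠ ε : ℝ in nhdsWithin 0 (Set.Ioi 0), ε < 1 :=
    (hlim (fun ε => ε) continuous_id).eventually_lt_const one_pos
  filter_upwards [ev1, ev2, self_mem_nhdsWithin] with ε h1 h2 h3
  have hε : 0 < ε := h3
  have h4 := hconv z y (1 - ε) ε (by linarith) hε.le (by ring) hz.le hy h1.le
  have h5 := neg_le_of_abs_le (abs_sub_tangentAt_le (r := r) hf hL z ((1 - ε) • z + ε • y))
  rw [tangentAt_combo _ _ _ _ _ (by ring), tangentAt_self] at h5
  have e : (1 - ε) • z + ε • y - z = ε • (y - z) := by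
    rw [sub_smul, one_smul, smul_sub]
    abel
  rw [e, norm_smul, Real.norm_of_nonneg hε.le] at h5
  have h6 : 0 ≤ r * (ε * ‖y - z‖) ^ 2 := by positivity
  have h7 : ε * tangentAt f r z y ≤ ε * (f y + r * ‖y‖ ^ 2 + ε * (L * ‖y - z‖ ^ 2)) := by
    linarith
  exact le_of_mul_le_mul_left h7 hε

/-- A smooth function that is convex outside a ball is within bounded distance of a convex
function. -/
theorem exists_convexOn_of_convex_outside_ball [Nontrivial F] (hf : Differentiable ℝ f)
    (hL : LipschitzWith L (gradient f)) (hr : 0 ≤ r) (hrL : r ≤ L) {ρ : ℝ} (hρ : 0 < ρ)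
    (hconv : ∀ x y : F, ∀ a b : ℝ, 0 ≤ a → 0 ≤ b → a + b = 1 → ρ ≤ ‖x‖ → ρ ≤ ‖y‖ →
      ρ ≤ ‖a • x + b • y‖ → f (a • x + b • y) + r * ‖a • x + b • y‖ ^ 2
        ≤ a * (f x + r * ‖x‖ ^ 2) + b * (f y + r * ‖y‖ ^ 2)) :
    ∃ W : F → ℝ, ConvexOn ℝ Set.univ W ∧
      (∀ x, W x ≤ f x + r * ‖x‖ ^ 2 + 20 * (L * ρ ^ 2)) ∧
      ∀ x, f x + r * ‖x‖ ^ 2 ≤ W x + 28 * (L * ρ ^ 2) := by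
  have hK : ∀ {z y : F}, ρ < ‖z‖ → ρ ≤ ‖y‖ → tangentAt f r z y ≤ f y + r * ‖y‖ ^ 2 :=
    fun hz hy => tangentAt_le_of_convex_outside hf hL hr hconv hz hy
  have hL0 : (0 : ℝ) ≤ L := L.2
  -- A point `x`, even inside the ball, is the midpoint of `x ± w`, both outside when `w` is long;
  -- this bounds all tangents at `x` uniformly.
  have hmid : ∀ {x w : F}, ‖x‖ + ρ ≤ ‖w‖ → ∀ {z}, ρ < ‖z‖ → tangentAt f r z x
      ≤ (1 / 2) * (f (x + w) + r * ‖x + w‖ ^ 2) + (1 / 2) * (f (x - w) + r * ‖x - w‖ ^ 2) := by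
    intro x w hw z hz
    have e : x = (1 / 2 : ℝ) • (x + w) + (1 / 2 : ℝ) • (x - w) := by
      rw [← smul_add, add_add_sub_cancel, ← two_smul ℝ x, smul_smul]
      norm_num
    have h1 : ρ ≤ ‖x + w‖ := by
      have := norm_sub_le (x + w) x
      rw [add_sub_cancel_left] at this
      linarith
    have h2 : ρ ≤ ‖x - w‖ := by
      have := norm_sub_le x (x - w)
      rw [sub_sub_cancel] at this
      linarith
    nth_rw 1 [e]
    rw [tangentAt_combo _ _ _ _ _ (by norm_num)]
    exact add_le_add (mul_le_mul_of_nonneg_left (hK hz h1) (by norm_num))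
      (mul_le_mul_of_nonneg_left (hK hz h2) (by norm_num))
  have hbdd : ∀ x, BddAbove (Set.range fun z : {z : F // ρ < ‖z‖} => tangentAt f r z x) := by
    intro x
    obtain ⟨w, hw⟩ := exists_norm_eq F (c := ‖x‖ + ρ) (by positivity)
    refine ⟨(1 / 2) * (f (x + w) + r * ‖x + w‖ ^ 2)
      + (1 / 2) * (f (x - w) + r * ‖x - w‖ ^ 2), ?_⟩
    rintro _ ⟨z, rfl⟩
    exact hmid hw.ge z.2
  obtain ⟨p, hp⟩ := exists_norm_eq F (c := 2 * ρ) (by positivity)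
  have hpρ : ρ < ‖p‖ := by rw [hp]; linarith
  have : Nonempty {z : F // ρ < ‖z‖} := ⟨⟨p, hpρ⟩⟩
  have hle : ∀ {x z}, ρ < ‖z‖ → tangentAt f r z x ≤ ⨆ z : {z : F // ρ < ‖z‖}, tangentAt f r z x :=
    fun {x z} hz => le_ciSup (hbdd x) ⟨z, hz⟩
  have h0 : ∀ x, |f x + r * ‖x‖ ^ 2 - tangentAt f r 0 x| ≤ 2 * (L * ‖x‖ ^ 2) := by
    intro x
    have h1 := abs_sub_tangentAt_le (r := r) hf hL 0 x
    rw [sub_zero] at h1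
    have h2 : r * ‖x‖ ^ 2 ≤ L * ‖x‖ ^ 2 := mul_le_mul_of_nonneg_right hrL (sq_nonneg _)
    have h3 : 0 ≤ r * ‖x‖ ^ 2 := by positivity
    rw [abs_le] at h1 ⊢
    constructor <;> linarith [h1.1, h1.2]
  have h0' : ∀ x {C : ℝ}, ‖x‖ ≤ C * ρ →
      |f x + r * ‖x‖ ^ 2 - tangentAt f r 0 x| ≤ 2 * C ^ 2 * (L * ρ ^ 2) := by
    intro x C hx
    have h1 := mul_le_mul_of_nonneg_left (pow_le_pow_left₀ (norm_nonneg _) hx 2) hL0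
    have := h0 x
    rw [mul_pow] at h1
    linarith
  have hLρ : 0 ≤ L * ρ ^ 2 := by positivity
  refine ⟨fun x => ⨆ z : {z : F // ρ < ‖z‖}, tangentAt f r z x, ⟨convex_univ, ?_⟩,
    fun x => ?_, fun x => ?_⟩
  · intro x _ y _ a b ha hb hab
    refine ciSup_le fun z => ?_
    rw [tangentAt_combo _ _ _ _ _ hab]
    exact add_le_add (mul_le_mul_of_nonneg_left (hle z.2) ha)
      (mul_le_mul_of_nonneg_left (hle z.2) hb)
  · refine ciSup_le fun z => ?_
    rcases lt_or_ge ρ ‖x‖ with hx | hx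
    · linarith [hK z.2 hx.le]
    -- The points `x ± p` have norm at most `3ρ`, so their values exceed the tangent at `0` by at
    -- most `18Lρ²`; returning to `x` costs `2Lρ²`, in total `20`.
    have h1 := hmid (x := x) (w := p) (by linarith) z.2
    have h2 := le_of_abs_le (h0' (x + p) (C := 3) ((norm_add_le _ _).trans (by linarith)))
    have h3 := le_of_abs_le (h0' (x - p) (C := 3) ((norm_sub_le _ _).trans (by linarith)))
    have h4 := neg_le_of_abs_le (h0' x (C := 1) (by linarith))
    have h5 := tangentAt_combo f r 0 (x + p) (x - p) (a := 1 / 2) (b := 1 / 2) (by norm_num)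
    have e : (1 / 2 : ℝ) • (x + p) + (1 / 2 : ℝ) • (x - p) = x := by
      rw [← smul_add, add_add_sub_cancel, ← two_smul ℝ x, smul_smul]
      norm_num
    rw [e] at h5
    linarith
  · simp only
    rcases lt_or_ge ρ ‖x‖ with hx | hx
    · have := hle (x := x) hx
      rw [tangentAt_self] at this
      linarith
    -- The tangent at `p`, with `‖p‖ = 2ρ`, bounds `W` below. The losses are `8` from `p` to the
    -- tangent at `0`, `6 * 3 = 18` from the change of slope over distance `3ρ`, and `2` at `x`: in
    -- total `28`.
    have h1 := hle (x := x) hpρ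
    have h2 := neg_le_of_abs_le (h0' p (C := 2) hp.le)
    have h4 := le_of_abs_le (h0' x (C := 1) (by linarith))
    have h5 : tangentAt f r p x - tangentAt f r 0 x = (f p + r * ‖p‖ ^ 2 - tangentAt f r 0 p)
        + inner ℝ (gradient f p - gradient f 0 + (2 * r) • p) (x - p) := by
      simp only [tangentAt, sub_zero, smul_zero, add_zero, inner_add_left, inner_sub_left,
        inner_sub_right]
      ring
    have h6 : ‖gradient f p - gradient f 0 + (2 * r) • p‖ ≤ 3 * L * (2 * ρ) := by
      have g1 := hL.norm_sub_le p 0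
      rw [sub_zero, hp] at g1
      have g2 : ‖(2 * r) • p‖ = 2 * r * (2 * ρ) := by
        rw [norm_smul, Real.norm_of_nonneg (by positivity), hp]
      have g3 : 2 * r * (2 * ρ) ≤ 2 * L * (2 * ρ) :=
        mul_le_mul_of_nonneg_right (by linarith) (by positivity)
      have := norm_add_le (gradient f p - gradient f 0) ((2 * r) • p)
      linarith
    have h7 : ‖x - p‖ ≤ 3 * ρ := (norm_sub_le _ _).trans (by linarith)
    have h8 := neg_le_of_abs_le
      (abs_real_inner_le_norm (gradient f p - gradient f 0 + (2 * r) • p) (x - p))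
    have h9 := mul_le_mul h6 h7 (norm_nonneg _) (by positivity)
    have h10 : 3 * L * (2 * ρ) * (3 * ρ) = 18 * (L * ρ ^ 2) := by ring
    linarith

end Convexification

/-! ### The posterior measure. -/

namespace ReverseDiffusion

variable {d : ℕ}

theorem ConvexOutsideBall.combo_le {v : E d → ℝ} {ρ : ℝ} (h : ConvexOutsideBall v ρ) (x y : E d)
    (a b : ℝ) (ha : 0 ≤ a) (hb : 0 ≤ b) (hab : a + b = 1) (hx : ρ ≤ ‖x‖) (hy : ρ ≤ ‖y‖)
    (hxy : ρ ≤ ‖a • x + b • y‖) : v (a • x + b • y) ≤ a * v x + b * v y := by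
  have := h 2 ![a, b] ![x, y] (by simp [Fin.forall_fin_two, ha, hb]) (by simpa using hab)
    (by simp [Fin.forall_fin_two, hx, hy]) (by simpa using hxy)
  simpa using this

/-- In dimension zero, for `ρ ≤ 0`, or for `r > L`, the function is already convex and serves as
`W`; otherwise the tangent construction applies. -/
theorem ConvexOutsideBall.exists_convexOn {f : E d → ℝ} {r ρ : ℝ} {L : ℝ≥0}
    (hf : Differentiable ℝ f) (hL : LipschitzWith L (gradient f)) (hr : 0 ≤ r)
    (h : ConvexOutsideBall (fun x => f x + r * ‖x‖ ^ 2) ρ) :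
    ∃ W : E d → ℝ, ConvexOn ℝ Set.univ W ∧
      (∀ x, W x ≤ f x + r * ‖x‖ ^ 2 + 20 * (L * ρ ^ 2)) ∧
      ∀ x, f x + r * ‖x‖ ^ 2 ≤ W x + 28 * (L * ρ ^ 2) := by
  have hLρ : 0 ≤ L * ρ ^ 2 := by positivity
  suffices hs : ConvexOn ℝ Set.univ (fun x => f x + r * ‖x‖ ^ 2) ∨
      (Nontrivial (E d) ∧ r ≤ L ∧ 0 < ρ) by
    rcases hs with hs | ⟨_, hrL, hρ⟩
    · exact ⟨_, hs, fun x => by linarith, fun x => by linarith⟩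
    · exact exists_convexOn_of_convex_outside_ball hf hL hr hrL hρ h.combo_le
  rcases subsingleton_or_nontrivial (E d) with hd | hd
  · refine Or.inl ⟨convex_univ, fun x _ y _ a b _ _ hab => ?_⟩
    rw [Subsingleton.elim (a • x + b • y) x, Subsingleton.elim y x, ← add_smul, hab, one_smul]
  rcases le_or_gt ρ 0 with hρ | hρ
  · exact Or.inl ⟨convex_univ, fun x _ y _ a b ha hb hab => h.combo_le x y a b ha hb hab
      (hρ.trans (norm_nonneg _)) (hρ.trans (norm_nonneg _)) (hρ.trans (norm_nonneg _))⟩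
  rcases le_or_gt r L with hrL | hrL
  · exact Or.inr ⟨hd, hrL, hρ⟩
  refine Or.inl (convexOn_of_tangentAt_le fun z x => ?_)
  have h1 := neg_le_of_abs_le (abs_sub_tangentAt_le (r := r) hf hL z x)
  have h2 := mul_le_mul_of_nonneg_right hrL.le (sq_nonneg ‖x - z‖)
  linarith

/-- At time zero, `f` is minus the log-density up to a constant, so `∇f` is minus the score. -/
theorem ScoreLipschitz.differentiable_and_lipschitzWith {f : E d → ℝ} {L : ℝ≥0}
    (hf : Integrable fun x => Real.exp (-f x)) (h : ScoreLipschitz f L) :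
    Differentiable ℝ f ∧ LipschitzWith L (gradient f) := by
  obtain ⟨h1, h2⟩ := h 0 le_rfl
  set k := Real.log (∫ y, Real.exp (-f y)) with hk
  set s : E d → ℝ := fun x => Real.log (forwardDensity f 0 x) with hs
  have hfs : f = fun x => -s x - k := by
    ext x
    simp only [hs, forwardDensity, if_true, targetDensity]
    rw [Real.log_div (Real.exp_pos _).ne' (integral_exp_pos hf).ne', Real.log_exp]
    ring
  have hg : gradient f = fun x => -gradient s x := by
    ext1 x
    rw [hfs, gradient, fderiv_sub_const, fderiv_fun_neg, map_neg, gradient]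
  refine ⟨?_, ?_⟩
  · rw [hfs]
    exact h1.neg.sub_const k
  · rw [hg]
    exact h2.neg

theorem satisfiesLSI_posterior {f : E d → ℝ} (hf : Integrable fun x => Real.exp (-f x)) {L : ℝ≥0}
    (hd : Differentiable ℝ f) (hL : LipschitzWith L (gradient f)) {t : ℝ} (ht : 0 < t) {ρ : ℝ}
    (h : ConvexOutsideBall
      (fun x => f x + Real.exp (-2 * t) / (6 * (1 - Real.exp (-2 * t))) * ‖x‖ ^ 2) ρ) (x : E d) :
    SatisfiesLSI (posterior f t x) (Real.exp (-2 * t) / (6 * (1 - Real.exp (-2 * t))) *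
          Real.exp (-48 * (L : ℝ) * ρ ^ 2)) := by
  set e := Real.exp (-t) with he
  have he2 : Real.exp (-2 * t) = e ^ 2 := by
    rw [he, sq, ← Real.exp_add]
    ring_nf
  have he0 : 0 < e := Real.exp_pos _
  have he1 : e ^ 2 < 1 := by
    rw [← he2, Real.exp_lt_one_iff]
    linarith
  rw [he2] at h ⊢
  set σ := 1 - e ^ 2 with hσ
  have hσ0 : 0 < σ := by linarith
  set r := e ^ 2 / (6 * σ) with hr
  have hr0 : 0 < r := by positivity
  obtain ⟨W, hW, hWβ, hWα⟩ := h.exists_convexOn hd hL hr0.le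
  set q : E d → ℝ := fun y => ‖x - e • y‖ ^ 2 / (2 * σ) with hq
  have hpost : posterior f t x = gibbs fun y => f y + q y := by
    simp only [posterior, if_neg ht.ne', gibbs, posteriorWeight, he2, ← he, ← hσ, hq, neg_add,
      sub_eq_add_neg]
  have hqe : ∀ y, q y = 3 * r * ‖y‖ ^ 2 + (-(e / σ) * inner ℝ x y + ‖x‖ ^ 2 / (2 * σ)) := by
    intro y
    simp only [hq, hr]
    rw [norm_sub_sq_real, inner_smul_right, norm_smul, Real.norm_of_nonneg he0.le]
    field_simp
    ring
  have hWc : Continuous W := by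
    have := hW.continuousOn isOpen_univ
    rwa [continuousOn_univ] at this
  have hqc : Continuous q := by fun_prop
  -- After one share `r‖y‖²` has gone into `W`, there remains `2r‖y‖² = (4r / 2)‖y‖²` plus an affine
  -- term.
  have hstrong : StrongConvexOn Set.univ (4 * r) fun y => W y + (q y - r * ‖y‖ ^ 2) := by
    rw [strongConvexOn_iff_convex]
    have e1 : (fun y => W y + (q y - r * ‖y‖ ^ 2) - 4 * r / (2 : ℝ) * ‖y‖ ^ 2)
        = fun y => W y + (-(e / σ) * inner ℝ x y + ‖x‖ ^ 2 / (2 * σ)) := by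
      ext y
      rw [hqe]
      ring
    rw [e1]
    refine hW.add ⟨convex_univ, fun y _ z _ a b _ _ hab => le_of_eq ?_⟩
    simp only [inner_add_right, inner_smul_right, smul_eq_mul]
    linear_combination (-(‖x‖ ^ 2 / (2 * σ))) * hab
  have hint : Integrable fun y => Real.exp (-(f y + q y)) := by
    refine hf.mono' (hd.continuous.add hqc).neg.rexp.aestronglyMeasurable
      (Filter.Eventually.of_forall fun y => ?_)
    rw [Real.norm_of_nonneg (Real.exp_pos _).le, Real.exp_le_exp]
    have : 0 ≤ q y := by positivity
    linarith
  rw [hpost]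
  have key := satisfiesLSI_gibbs_of_le hint (hd.continuous.add hqc).measurable
    (W := fun y => W y + (q y - r * ‖y‖ ^ 2)) (hWc.add (by fun_prop)).measurable (by positivity)
    hstrong (α := 28 * (L * ρ ^ 2)) (β := 20 * (L * ρ ^ 2)) (fun y => by linarith [hWβ y])
    (fun y => by linarith [hWα y])
  have hexp : -(28 * (L * ρ ^ 2) + 20 * (L * ρ ^ 2)) = -48 * (L : ℝ) * ρ ^ 2 := by ring
  rw [hexp] at key
  exact key.mono (by positivity) (mul_le_mul_of_nonneg_right (by linarith) (Real.exp_pos _).le)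

end ReverseDiffusion

end

theorem lemma3 (d : ℕ) (f : ReverseDiffusion.E d → ℝ)
    (hf : MeasureTheory.Integrable (fun x => Real.exp (-f x)))
    (L : ℝ≥0) (hA1 : ReverseDiffusion.ScoreLipschitz f L)
    (R : ℝ → ℝ) (hA4 : ReverseDiffusion.ConvexifiableOutside f R) :
    (∀ t : ℝ, 0 < t → ∀ x : ReverseDiffusion.E d,
      ReverseDiffusion.SatisfiesLSI (ReverseDiffusion.posterior f t x)
        (Real.exp (-2 * t) / (6 * (1 - Real.exp (-2 * t))) *
          Real.exp (-48 * (L : ℝ) *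
            (R (Real.exp (-2 * t) / (6 * (1 - Real.exp (-2 * t))))) ^ 2))) ∧
    (∀ x : ReverseDiffusion.E d, ∀ μ : ℝ, 0 < μ →
      ReverseDiffusion.SatisfiesLSI (ReverseDiffusion.posterior f 0 x) μ) := by
  obtain ⟨hd, hL⟩ := hA1.differentiable_and_lipschitzWith hf
  refine ⟨fun t ht x => ReverseDiffusion.satisfiesLSI_posterior hf hd hL ht (hA4 _ ?_) x,
    fun x μ hμ => ?_⟩
  · have h1 : Real.exp (-2 * t) < 1 := Real.exp_lt_one_iff.2 (by linarith)
    have h2 : 0 < 1 - Real.exp (-2 * t) := by linarith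
    positivity
  · rw [ReverseDiffusion.posterior, if_pos rfl]
    exact ReverseDiffusion.satisfiesLSI_dirac x hμ
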